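/- Let $\Bbbk$ be an algebraically closed field of characteristic $0$ and let $H$ be a Hopf algebra over $\Bbbk$, with comultiplication $\Delta$; write $\otimes=\otimes_{\Bbbk}$, $H^*=\operatorname{Hom}_{\Bbbk}(H,\Bbbk)$, and let $\tau(a\otimes b)=b\otimes a$ be the switch map on $H\otimes H$. Assume that $H$ is semisimple as a ring and that $(H,R)$ is factorizable for some $R\in H\otimes H$, that is: (a) $R$ is a unit of the algebra $H\otimes H$ and $\tau(\Delta(h))\,R=R\,\Delta(h)$ for all $h\in H$; (b) $(\Delta\otimes\mathrm{id})(R)=R_{13}R_{23}$ and $(\mathrm{id}\otimes\Delta)(R)=R_{13}R_{12}$ in $H\otimes H\otimes H$, where for $R=\sum_i a_i\otimes b_i$ we put $R_{12}=\sum_i a_i\otimes b_i\otimes 1$, $R_{13}=\sum_i a_i\otimes 1\otimes b_i$ and $R_{23}=\sum_i 1\otimes a_i\otimes b_i$; (c) the linear map $\Phi_R\colon H^*\to H$, $f\mapsto(\mathrm{id}\otimes f)(\tau(R)R)$, is bijective (this forces $H$ to be finite-dimensional). Then $(\dim_{\Bbbk}S)^2$ divides $\dim_{\Bbbk}H$ for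 every irreducible $H$-module $S$. -/

import Mathlib

open scoped TensorProduct

namespace HopfAlgebra

noncomputable section

variable (k : Type*) {H : Type*} [Field k] [Ring H] [HopfAlgebra k H]

/-- The switch map `τ(a ⊗ b) = b ⊗ a`, an algebra automorphism of `H ⊗ H`. -/
def switch : H ⊗[k] H ≃ₐ[k] H ⊗[k] H :=
  Algebra.TensorProduct.comm k H H

/-- `R₁₂ = R¹ ⊗ R² ⊗ 1`, for `R = R¹ ⊗ R²`. -/
def leg12 : H ⊗[k] H →ₐ[k] H ⊗[k] (H ⊗[k] H) :=
  Algebra.TensorProduct.map (AlgHom.id k H) Algebra.TensorProduct.includeLeft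

/-- `R₁₃ = R¹ ⊗ 1 ⊗ R²`, for `R = R¹ ⊗ R²`. -/
def leg13 : H ⊗[k] H →ₐ[k] H ⊗[k] (H ⊗[k] H) :=
  Algebra.TensorProduct.map (AlgHom.id k H) Algebra.TensorProduct.includeRight

/-- `R₂₃ = 1 ⊗ R¹ ⊗ R²`, for `R = R¹ ⊗ R²`. -/
def leg23 : H ⊗[k] H →ₐ[k] H ⊗[k] (H ⊗[k] H) :=
  Algebra.TensorProduct.includeRight

/-- `(H, R)` is almost cocommutative: `R` is a unit of `H ⊗ H` with `τ(Δ(h)) R = R Δ(h)` for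
all `h`. -/
structure IsAlmostCocommutative (R : H ⊗[k] H) : Prop where
  isUnit : IsUnit R
  switch_comul_mul : ∀ h : H,
    switch k (Coalgebra.comul (R := k) h) * R = R * Coalgebra.comul (R := k) h

/-- `(H, R)` is quasitriangular: it is almost cocommutative,
`Δ(R¹) ⊗ R² = R¹ ⊗ r¹ ⊗ R² r²` and `R¹ ⊗ Δ(R²) = R¹ r¹ ⊗ r² ⊗ R²`,
where `R = R¹ ⊗ R² = r¹ ⊗ r²`. -/
structure IsQuasitriangular (R : H ⊗[k] H) : Prop extends IsAlmostCocommutative k R where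
  comul_rTensor :
    TensorProduct.assoc k H H H ((Coalgebra.comul (R := k) (A := H)).rTensor H R) =
      leg13 k R * leg23 k R
  comul_lTensor :
    (Coalgebra.comul (R := k) (A := H)).lTensor H R = leg13 k R * leg12 k R

/-- The contraction `f ↦ b¹ f(b²)` from `H* = Hom_k(H, k)` to `H` given by `b = b¹ ⊗ b²`. -/
def contractRight (b : H ⊗[k] H) : Module.Dual k H →ₗ[k] H :=
  (TensorProduct.rid k H).toLinearMap ∘ₗ LinearMap.applyₗ b ∘ₗ LinearMap.lTensorHom H

/-- The map `Φ_R : H* → H`, `f ↦ b¹ f(b²)`, where `b = τ(R) R`. -/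
def drinfeldMap (R : H ⊗[k] H) : Module.Dual k H →ₗ[k] H :=
  contractRight k (switch k R * R)

/-- `(H, R)` is factorizable: it is quasitriangular and `Φ_R` is bijective. -/
structure IsFactorizable (R : H ⊗[k] H) : Prop extends IsQuasitriangular k R where
  bijective_drinfeldMap : Function.Bijective (drinfeldMap k R)

end

end HopfAlgebra

/-! Write `n` for the dimension of `H` and `d` for that of the simple module. The quotient `n / d²`
is shown to be a sum of products of algebraic integers, hence an algebraic integer; being rational,
it is an integer (`dvd_of_isIntegral_div`).

The Drinfeld map `Φ` identifies linear forms with elements of `H`. It is multiplicative when the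
right factor has central image (`drinfeldMap_dualMul`), and `Φ f` is central exactly when `f (y x) =
f (x S²(y))` (`forall_commute_iff`). Once `S² = id` is known, trace forms therefore correspond to
the centre. Let `E` be the form with `Φ E` the central idempotent of the block of the given simple
module, and let `Λ` be the normalized integral. If `f` is a character, then `Φ f` acts on that block
by a scalar `a f`, so that `E f = a f • E`. The numbers `a f` are algebraic integers, because
characters take natural values at `Λ` (`IsCharacter.isIntegral_eigenvalue`).

Expand `E = ∑ c_j χ_j` in the block characters. Orthogonality (`dualMul_blockTrace`) gives `c_j = a
(χ_j ∘ S) E(Λ)`, and `a E = 1` gives `1 = E(Λ) ∑ a χ_j · a (χ_j ∘ S)`. Comparing the regular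
character with the dual integral gives `n E(Λ) = d²`, so `n / d² = ∑ a χ_j · a (χ_j ∘ S)`
(`IsFactorizable.isIntegral_div`).

The remaining input, `S² = id`, is obtained in the style of Larson and Radford. The form `l` with `Φ
l = Λ` is a two-sided integral of the dual, invariant under `S`. The trace form `h ↦ Tr(L_h S²)` is
a multiple of `l`, which forces `Tr(S²) l(Λ) = 1`. Nondegeneracy of `l` then gives `S⁴ = id`, and an
integrality argument for `Tr(S²)` gives `S² = id` (`antipode_antipode_of_integrals`). -/

namespace HopfAlgebra

/-! ### The convolution algebra and the antipode as a convolution inverse -/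

section Convolution

open Coalgebra WithConv

variable {k H : Type*} [Field k] [Ring H] [HopfAlgebra k H]

lemma sum_counit_right_smul {ι : Type*} {h : H} (r : Repr k h ι) :
    ∑ i ∈ r.index, counit (R := k) (r.right i) • r.left i = h := by
  have h1 := congrArg (TensorProduct.rid k H) (lTensor_counit_comul (R := k) h)
  rw [← r.eq] at h1
  simpa only [map_sum, LinearMap.lTensor_tmul, TensorProduct.rid_tmul, one_smul] using h1

variable (k H) in
/-- The convolution algebra of linear maps from `H` to `A`. -/
abbrev ConvHom (A : Type*) [Ring A] [Algebra k A] := WithConv (H →ₗ[k] A)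

/-- The linear map `h ↦ ε(h) a`. -/
def convConst {A : Type*} [Ring A] [Algebra k A] (a : A) : ConvHom k H A :=
  toConv ((counit (R := k) (A := H)).smulRight a)

@[simp]
lemma convConst_apply {A : Type*} [Ring A] [Algebra k A] (a : A) (h : H) :
    convConst (k := k) a h = counit (R := k) h • a := rfl

lemma convConst_mul_apply {A : Type*} [Ring A] [Algebra k A] (a : A) (f : ConvHom k H A) (h : H) :
    (convConst a * f : ConvHom k H A) h = a * f h := by
  rw [(ℛ k h).convMul_apply]
  simp only [convConst_apply, smul_mul_assoc, ← mul_smul_comm, ← Finset.mul_sum]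
  congr 1
  conv_rhs => rw [← sum_counit_smul (ℛ k h)]
  simp [map_sum]

lemma mul_convConst_apply {A : Type*} [Ring A] [Algebra k A] (a : A) (f : ConvHom k H A) (h : H) :
    (f * convConst a : ConvHom k H A) h = f h * a := by
  rw [(ℛ k h).convMul_apply]
  simp only [convConst_apply, mul_smul_comm, ← smul_mul_assoc, ← Finset.sum_mul]
  congr 1
  conv_rhs => rw [← sum_counit_right_smul (ℛ k h)]
  simp [map_sum]

/-- `h ↦ g(S(h))`. -/
def compAntipode {A : Type*} [Ring A] [Algebra k A] (g : ConvHom k H A) : ConvHom k H A :=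
  toConv (g.ofConv ∘ₗ antipode k)

@[simp]
lemma compAntipode_apply {A : Type*} [Ring A] [Algebra k A] (g : ConvHom k H A) (h : H) :
    compAntipode g h = g (antipode k h) := rfl

/-- An algebra homomorphism as an element of the convolution algebra. -/
def convOfAlgHom {A : Type*} [Ring A] [Algebra k A] (g : H →ₐ[k] A) : ConvHom k H A :=
  toConv g.toLinearMap

@[simp]
lemma convOfAlgHom_apply {A : Type*} [Ring A] [Algebra k A] (g : H →ₐ[k] A) (h : H) :
    convOfAlgHom g h = g h := rfl

@[simp]
lemma convOfAlgHom_mul_compAntipode {A : Type*} [Ring A] [Algebra k A] (g : H →ₐ[k] A) :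
    convOfAlgHom g * compAntipode (convOfAlgHom g) = 1 := by
  ext h
  rw [(ℛ k h).convMul_apply]
  simp only [convOfAlgHom_apply, compAntipode_apply, ← map_mul, ← map_sum]
  rw [sum_mul_antipode_eq_algebraMap_counit]
  simp

@[simp]
lemma compAntipode_mul_convOfAlgHom {A : Type*} [Ring A] [Algebra k A] (g : H →ₐ[k] A) :
    compAntipode (convOfAlgHom g) * convOfAlgHom g = 1 := by
  ext h
  rw [(ℛ k h).convMul_apply]
  simp only [convOfAlgHom_apply, compAntipode_apply, ← map_mul, ← map_sum]
  rw [sum_antipode_mul_eq_algebraMap_counit]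
  simp

variable (k H) in
/-- `h ↦ h ⊗ 1`. -/
def leg1 : H →ₐ[k] H ⊗[k] H := Algebra.TensorProduct.includeLeft

variable (k H) in
/-- `h ↦ 1 ⊗ h`. -/
def leg2 : H →ₐ[k] H ⊗[k] H := Algebra.TensorProduct.includeRight

@[simp] lemma leg1_apply (h : H) : leg1 k H h = h ⊗ₜ 1 := rfl

@[simp] lemma leg2_apply (h : H) : leg2 k H h = 1 ⊗ₜ h := rfl

lemma leg1_mul_leg2 :
    convOfAlgHom (leg1 k H) * convOfAlgHom (leg2 k H) =
      convOfAlgHom (Bialgebra.comulAlgHom k H) := by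
  ext h
  rw [(ℛ k h).convMul_apply]
  simp [(ℛ k h).eq]

lemma leg2_mul_leg1 :
    convOfAlgHom (leg2 k H) * convOfAlgHom (leg1 k H) =
      convOfAlgHom ((switch k).toAlgHom.comp (Bialgebra.comulAlgHom k H)) := by
  ext h
  rw [(ℛ k h).convMul_apply]
  simp [switch, ← (ℛ k h).eq]

/-- Both sides are convolution inverses of `Δ`, which is the product of the two leg embeddings. -/
lemma comul_antipode_eq_convMul :
    compAntipode (convOfAlgHom (Bialgebra.comulAlgHom k H)) =
      compAntipode (convOfAlgHom (leg2 k H)) * compAntipode (convOfAlgHom (leg1 k H)) := by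
  refine left_inv_eq_right_inv (compAntipode_mul_convOfAlgHom _) ?_
  rw [← leg1_mul_leg2, mul_assoc, ← mul_assoc (convOfAlgHom (leg2 k H))]
  simp

variable (k H) in
/-- `S ⊗ S`. -/
def antipodeTensor : H ⊗[k] H →ₗ[k] H ⊗[k] H := TensorProduct.map (antipode k) (antipode k)

@[simp] lemma antipodeTensor_tmul (x y : H) :
    antipodeTensor k H (x ⊗ₜ y) = antipode k x ⊗ₜ antipode k y := rfl

lemma antipodeTensor_mul (s t : H ⊗[k] H) :
    antipodeTensor k H (s * t) = antipodeTensor k H t * antipodeTensor k H s := by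
  induction s with
  | zero => simp
  | add s s' h h' => simp [add_mul, mul_add, h, h']
  | tmul x y =>
    induction t with
    | zero => simp
    | add s s' h h' => simp [add_mul, mul_add, h, h']
    | tmul x' y' => simp [antipode_mul_antidistrib]

lemma antipodeTensor_switch (s : H ⊗[k] H) :
    antipodeTensor k H (switch k s) = switch k (antipodeTensor k H s) := by
  induction s with
  | zero => simp
  | add s s' h h' => simp [h, h']
  | tmul x y => simp [switch]

lemma comul_antipode (h : H) :
    comul (R := k) (antipode k h) = antipodeTensor k H (switch k (comul h)) := by
  have := congr($(comul_antipode_eq_convMul (k := k) (H := H)) h)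
  rw [(ℛ k h).convMul_apply] at this
  simpa [switch, ← (ℛ k h).eq] using this

@[simp] lemma switch_switch (s : H ⊗[k] H) : switch k (switch k s) = s :=
  (TensorProduct.comm k H H).symm_apply_apply s

@[simp] lemma switch_tmul (x y : H) : switch k (x ⊗ₜ[k] y) = y ⊗ₜ x := rfl

end Convolution

/-! ### Counit and antipode identities for the R-matrix -/

section RMatrix

open Coalgebra

variable {k H : Type*} [Field k] [Ring H] [HopfAlgebra k H] {R : H ⊗[k] H}

variable (k H) in
/-- `ε ⊗ id`. -/
def counitLeft : H ⊗[k] H →ₐ[k] H :=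
  (Algebra.TensorProduct.lid k H).toAlgHom.comp
    (Algebra.TensorProduct.map (Bialgebra.counitAlgHom k H) (AlgHom.id k H))

variable (k H) in
/-- `id ⊗ ε`. -/
def counitRight : H ⊗[k] H →ₐ[k] H :=
  (counitLeft k H).comp (switch k).toAlgHom

@[simp] lemma counitLeft_tmul (x y : H) :
    counitLeft k H (x ⊗ₜ y) = counit (R := k) x • y := by
  simp [counitLeft]

@[simp] lemma counitRight_tmul (x y : H) :
    counitRight k H (x ⊗ₜ y) = counit (R := k) y • x := by
  simp [counitRight, switch]

@[simp] lemma counitLeft_comul (h : H) : counitLeft k H (comul h) = h := by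
  conv_lhs => rw [← (ℛ k h).eq]
  simp only [map_sum, counitLeft_tmul]
  exact sum_counit_smul (ℛ k h)

@[simp] lemma counitRight_comul (h : H) : counitRight k H (comul h) = h := by
  conv_lhs => rw [← (ℛ k h).eq]
  simp only [map_sum, counitRight_tmul]
  exact sum_counit_right_smul (ℛ k h)

lemma counitLeft_switch (t : H ⊗[k] H) : counitLeft k H (switch k t) = counitRight k H t := rfl

lemma assoc_rTensor_comul_tmul (x y : H) :
    TensorProduct.assoc k H H H ((comul (R := k) (A := H)).rTensor H (x ⊗ₜ y)) =
      ∑ i ∈ (ℛ k x).index, (ℛ k x).left i ⊗ₜ ((ℛ k x).right i ⊗ₜ y) := by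
  rw [LinearMap.rTensor_tmul, ← (ℛ k x).eq]
  simp [TensorProduct.sum_tmul]

lemma lTensor_comul_tmul (x y : H) :
    (comul (R := k) (A := H)).lTensor H (x ⊗ₜ y) =
      ∑ i ∈ (ℛ k y).index, x ⊗ₜ ((ℛ k y).left i ⊗ₜ (ℛ k y).right i) := by
  rw [LinearMap.lTensor_tmul, ← (ℛ k y).eq]
  simp [TensorProduct.tmul_sum]

@[simp] lemma leg12_tmul (x y : H) : leg12 k (x ⊗ₜ y) = x ⊗ₜ (y ⊗ₜ 1) := rfl
@[simp] lemma leg13_tmul (x y : H) : leg13 k (x ⊗ₜ y) = x ⊗ₜ (1 ⊗ₜ y) := rfl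
@[simp] lemma leg23_tmul (x y : H) : leg23 k (x ⊗ₜ y) = 1 ⊗ₜ (x ⊗ₜ y) := rfl

/-- Applying the counit to the first leg of the first hexagon identity gives `R = (1 ⊗ (ε ⊗ id)(R))
R`, and the unit `R` cancels. -/
lemma IsQuasitriangular.counitLeft_eq_one (hR : IsQuasitriangular k R) :
    counitLeft k H R = 1 := by
  let G : H ⊗[k] (H ⊗[k] H) →ₐ[k] H ⊗[k] H :=
    (Algebra.TensorProduct.lid k _).toAlgHom.comp
      (Algebra.TensorProduct.map (Bialgebra.counitAlgHom k H) (AlgHom.id k _))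
  have h1 : ∀ t, G (TensorProduct.assoc k H H H ((comul (R := k) (A := H)).rTensor H t)) = t := by
    intro t
    induction t with
    | zero => simp
    | add s t hs ht => simp only [map_add, hs, ht]
    | tmul x y =>
      rw [assoc_rTensor_comul_tmul]
      simp only [G, map_sum]
      simp [TensorProduct.smul_tmul', ← TensorProduct.sum_tmul, sum_counit_smul (ℛ k x)]
  have h2 : ∀ t, G (leg13 k t) = leg2 k H (counitLeft k H t) := by
    intro t
    induction t with
    | zero => simp
    | add s t hs ht => simp only [map_add, hs, ht]
    | tmul x y => simp [G]
  have h3 : ∀ t, G (leg23 k t) = t := by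
    intro t
    induction t with
    | zero => simp
    | add s t hs ht => simp only [map_add, hs, ht]
    | tmul x y => simp [G]
  have h4 := congrArg G hR.comul_rTensor
  rw [h1, map_mul, h2, h3] at h4
  have h5 : leg2 k H (counitLeft k H R) = 1 :=
    hR.isUnit.mul_right_cancel (by rw [← h4, one_mul])
  simpa using congrArg (counitLeft k H) h5

lemma IsQuasitriangular.counitRight_eq_one (hR : IsQuasitriangular k R) :
    counitRight k H R = 1 := by
  let G : H ⊗[k] (H ⊗[k] H) →ₐ[k] H ⊗[k] H :=
    Algebra.TensorProduct.map (AlgHom.id k H) (counitLeft k H)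
  have h1 : ∀ t, G ((comul (R := k) (A := H)).lTensor H t) = t := by
    intro t
    induction t with
    | zero => simp
    | add s t hs ht => simp only [map_add, hs, ht]
    | tmul x y => simp [G]
  have h2 : ∀ t, G (leg12 k t) = leg1 k H (counitRight k H t) := by
    intro t
    induction t with
    | zero => simp
    | add s t hs ht => simp only [map_add, hs, ht]
    | tmul x y => simp [G]
  have h3 : ∀ t, G (leg13 k t) = t := by
    intro t
    induction t with
    | zero => simp
    | add s t hs ht => simp only [map_add, hs, ht]
    | tmul x y => simp [G]
  have h4 := congrArg G hR.comul_lTensor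
  rw [h1, map_mul, h2, h3] at h4
  have h5 : leg1 k H (counitRight k H R) = 1 :=
    hR.isUnit.mul_left_cancel (by rw [← h4, mul_one])
  simpa using congrArg (counitRight k H) h5

lemma IsQuasitriangular.antipode_rTensor_mul (hR : IsQuasitriangular k R) :
    (antipode k (A := H)).rTensor H R * R = 1 := by
  let K : H ⊗[k] (H ⊗[k] H) →ₗ[k] H ⊗[k] H :=
    (LinearMap.mul' k H ∘ₗ (antipode k (A := H)).rTensor H).rTensor H ∘ₗ
      (TensorProduct.assoc k H H H).symm.toLinearMap
  have hK : ∀ x y z : H, K (x ⊗ₜ (y ⊗ₜ z)) = (antipode k x * y) ⊗ₜ z := fun x y z ↦ by simp [K]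
  have h1 : ∀ t, K (TensorProduct.assoc k H H H ((comul (R := k) (A := H)).rTensor H t)) =
      leg2 k H (counitLeft k H t) := by
    intro t
    induction t with
    | zero => simp
    | add s t hs ht => simp only [map_add, hs, ht]
    | tmul x y =>
      rw [assoc_rTensor_comul_tmul]
      simp only [map_sum, hK, ← TensorProduct.sum_tmul, sum_antipode_mul_eq_smul]
      simp [TensorProduct.smul_tmul]
  have h2 : ∀ s t, K (leg13 k s * leg23 k t) = (antipode k (A := H)).rTensor H s * t := by
    intro s t
    induction s with
    | zero => simp
    | add s s' hs hs' => simp only [map_add, add_mul, hs, hs']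
    | tmul x y =>
      induction t with
      | zero => simp
      | add s s' hs hs' => simp only [map_add, mul_add, hs, hs']
      | tmul x' y' => simp [hK]
  have h4 := congrArg K hR.comul_rTensor
  rw [h1, h2, hR.counitLeft_eq_one, map_one] at h4
  exact h4.symm

/-- The map `x ⊗ y ⊗ z ↦ S(x) ⊗ y S(z)` turns the second hexagon identity into `1 = (S ⊗ id)(R) (S ⊗
S)(R)`. The first factor is already known to be the inverse of `R`. -/
lemma IsQuasitriangular.antipodeTensor_eq (hR : IsQuasitriangular k R) :
    antipodeTensor k H R = R := by
  let K : H ⊗[k] (H ⊗[k] H) →ₗ[k] H ⊗[k] H :=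
    TensorProduct.map (antipode k) (LinearMap.mul' k H ∘ₗ (antipode k (A := H)).lTensor H)
  have hK : ∀ x y z : H, K (x ⊗ₜ (y ⊗ₜ z)) = antipode k x ⊗ₜ (y * antipode k z) :=
    fun x y z ↦ by simp [K]
  have h1 : ∀ t, K ((comul (R := k) (A := H)).lTensor H t) =
      leg1 k H (antipode k (counitRight k H t)) := by
    intro t
    induction t with
    | zero => simp
    | add s t hs ht => simp only [map_add, hs, ht]
    | tmul x y =>
      rw [lTensor_comul_tmul]
      rw [map_sum]
      simp only [hK]
      rw [← TensorProduct.tmul_sum, sum_mul_antipode_eq_smul]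
      simp
  have h2 : ∀ s t, K (leg13 k s * leg12 k t) =
      (antipode k (A := H)).rTensor H t * antipodeTensor k H s := by
    intro s t
    induction s with
    | zero => simp
    | add s s' hs hs' => simp only [map_add, add_mul, mul_add, hs, hs']
    | tmul x y =>
      induction t with
      | zero => simp
      | add s s' hs hs' => simp only [map_add, mul_add, add_mul, hs, hs']
      | tmul x' y' => simp [hK, antipode_mul_antidistrib]
  have h4 := congrArg K hR.comul_lTensor
  rw [h1, h2, hR.counitRight_eq_one] at h4
  simp only [antipode_one, map_one] at h4
  have h5 := hR.antipode_rTensor_mul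
  obtain ⟨u, hu⟩ := hR.isUnit
  have h6 : (antipode k (A := H)).rTensor H R = ↑u⁻¹ := by
    rw [← Units.mul_eq_one_iff_eq_inv, hu, h5]
  rw [h6, eq_comm, Units.inv_mul_eq_one] at h4
  rw [← h4, hu]

lemma IsAlmostCocommutative.commute_comul (hR : IsAlmostCocommutative k R) (h : H) :
    Commute (switch k R * R) (comul (R := k) h) := by
  have h1 := congrArg (switch k) (hR.switch_comul_mul h)
  rw [map_mul, map_mul, switch_switch] at h1
  rw [Commute, SemiconjBy, mul_assoc, ← hR.switch_comul_mul, ← mul_assoc, ← h1, mul_assoc]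

lemma IsQuasitriangular.antipodeTensor_switch_mul (hR : IsQuasitriangular k R) :
    antipodeTensor k H (switch k R * R) = switch k (switch k R * R) := by
  rw [antipodeTensor_mul, antipodeTensor_switch, hR.antipodeTensor_eq, map_mul, switch_switch]

@[simp] lemma contractRight_tmul (x y : H) (f : Module.Dual k H) :
    contractRight k (x ⊗ₜ y) f = f y • x := by
  simp [contractRight]

lemma contractRight_add (s t : H ⊗[k] H) (f : Module.Dual k H) :
    contractRight k (s + t) f = contractRight k s f + contractRight k t f := by
  simp [contractRight]

@[simp] lemma contractRight_zero (f : Module.Dual k H) :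
    contractRight k (0 : H ⊗[k] H) f = 0 := by
  simp [contractRight]

lemma contractRight_sum {ι : Type*} (s : Finset ι) (t : ι → H ⊗[k] H) (f : Module.Dual k H) :
    contractRight k (∑ i ∈ s, t i) f = ∑ i ∈ s, contractRight k (t i) f := by
  simp [contractRight]

/-- The left legs of `b` span the range of the contraction given by `b`. -/
lemma finite_of_surjective_contractRight {b : H ⊗[k] H}
    (hb : Function.Surjective (contractRight k b)) : Module.Finite k H := by
  classical
  obtain ⟨s, rfl⟩ := TensorProduct.exists_finset b
  refine ⟨⟨s.image Prod.fst, top_le_iff.mp fun x _ ↦ ?_⟩⟩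
  obtain ⟨f, rfl⟩ := hb x
  rw [contractRight_sum]
  refine Submodule.sum_mem _ fun i hi ↦ ?_
  rw [contractRight_tmul]
  exact Submodule.smul_mem _ _ (Submodule.subset_span (by simpa using ⟨i.2, hi⟩))

lemma IsFactorizable.moduleFinite (hR : IsFactorizable k R) : Module.Finite k H :=
  finite_of_surjective_contractRight hR.bijective_drinfeldMap.2

/-- Since `S ⊗ S` fixes `R`, it has `τ(R) R` in its image. Hence every value of `Φ`, and so every
element of `H`, lies in the range of `S`. -/
lemma IsFactorizable.surjective_antipode (hR : IsFactorizable k R) :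
    Function.Surjective (antipode k (A := H)) := by
  intro x
  obtain ⟨f, rfl⟩ := hR.bijective_drinfeldMap.2 x
  suffices ∀ s t : H ⊗[k] H, contractRight k (antipodeTensor k H s * antipodeTensor k H t) f ∈
      LinearMap.range (antipode k (A := H)) by
    have h := this (switch k R) R
    rwa [antipodeTensor_switch, hR.antipodeTensor_eq] at h
  intro s t
  rw [← antipodeTensor_mul]
  induction t * s with
  | zero => simp
  | add s t hs ht => rw [map_add, contractRight_add]; exact add_mem hs ht
  | tmul x y =>
    rw [antipodeTensor_tmul, contractRight_tmul]
    exact Submodule.smul_mem _ _ ⟨x, rfl⟩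

lemma IsFactorizable.bijective_antipode (hR : IsFactorizable k R) :
    Function.Bijective (antipode k (A := H)) :=
  have := hR.moduleFinite
  ⟨LinearMap.injective_iff_surjective.mpr hR.surjective_antipode, hR.surjective_antipode⟩

end RMatrix

/-! ### The Drinfeld map: central elements and multiplicativity -/

section DrinfeldMap

open Coalgebra WithConv

variable {k H : Type*} [Field k] [Ring H] [HopfAlgebra k H] {R : H ⊗[k] H}

/-- The convolution product of linear forms. -/
noncomputable def dualMul (f g : Module.Dual k H) : Module.Dual k H :=
  (toConv f * toConv g : ConvHom k H k).ofConv

lemma dualMul_apply {ι : Type*} {h : H} (r : Repr k h ι) (f g : Module.Dual k H) :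
    dualMul f g h = ∑ i ∈ r.index, f (r.left i) * g (r.right i) :=
  r.convMul_apply (toConv f) (toConv g)

lemma dualMul_apply_map (f g : Module.Dual k H) (h : H) :
    dualMul f g h = LinearMap.mul' k k (TensorProduct.map f g (comul h)) := rfl

lemma dualMul_assoc (f g h : Module.Dual k H) :
    dualMul (dualMul f g) h = dualMul f (dualMul g h) :=
  congrArg ofConv (mul_assoc (toConv f : ConvHom k H k) (toConv g) (toConv h))

lemma smul_dualMul (c : k) (f g : Module.Dual k H) :
    dualMul (c • f) g = c • dualMul f g :=
  congrArg ofConv (smul_mul_assoc c (toConv f : ConvHom k H k) (toConv g))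

lemma counit_dualMul (f : Module.Dual k H) : dualMul (counit (R := k)) f = f :=
  congrArg ofConv (one_mul (toConv f : ConvHom k H k))

lemma dualMul_counit (f : Module.Dual k H) : dualMul f (counit (R := k)) = f :=
  congrArg ofConv (mul_one (toConv f : ConvHom k H k))

lemma sum_dualMul {ι : Type*} (s : Finset ι) (f : ι → Module.Dual k H) (g : Module.Dual k H) :
    dualMul (∑ i ∈ s, f i) g = ∑ i ∈ s, dualMul (f i) g := by
  classical
  induction s using Finset.induction_on with
  | empty => exact congrArg ofConv (zero_mul (toConv g : ConvHom k H k))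
  | insert a s ha ih =>
    rw [Finset.sum_insert ha, Finset.sum_insert ha, ← ih]
    exact congrArg ofConv (add_mul (toConv (f a) : ConvHom k H k) _ _)

/-- The adjoint action: `adjointAction h x = h₁ x S(h₂)`. -/
noncomputable def adjointAction : ConvHom k H (Module.End k H) :=
  convOfAlgHom (Algebra.lmul k H) * compAntipode (toConv (LinearMap.mul k H).flip)

lemma adjointAction_apply {ι : Type*} {h : H} (r : Repr k h ι) (x : H) :
    adjointAction (k := k) h x = ∑ i ∈ r.index, r.left i * x * antipode k (r.right i) := by
  rw [adjointAction, r.convMul_apply]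
  simp [mul_assoc]

lemma sum_antipode_left_antipode_antipode_right {ι : Type*} {h : H} (r : Repr k h ι) :
    ∑ i ∈ r.index, antipode k (antipode k (r.right i)) * antipode k (r.left i) =
      counit (R := k) h • 1 := by
  simp_rw [← antipode_mul_antidistrib]
  rw [← map_sum, sum_mul_antipode_eq_smul, map_smul, antipode_one]

lemma sum_antipode_right_antipode_antipode_left {ι : Type*} {h : H} (r : Repr k h ι) :
    ∑ i ∈ r.index, antipode k (r.right i) * antipode k (antipode k (r.left i)) =
      counit (R := k) h • 1 := by
  simp_rw [← antipode_mul_antidistrib]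
  rw [← map_sum, sum_antipode_mul_eq_smul, map_smul, antipode_one]

/-- A linear form is invariant under the coadjoint action if and only if it is a trace form
up to a twist by `S²`. -/
lemma forall_adjointAction_iff (f : Module.Dual k H) :
    (∀ h x, f (adjointAction (k := k) h x) = counit (R := k) h * f x) ↔
      ∀ y x, f (y * x) = f (x * antipode k (antipode k y)) := by
  constructor
  · intro hf y x
    -- Convolving with the inverse of the right factor recovers left multiplication: `∑ ad(y₁)(x
    -- S²(y₂)) = y x`.
    have h1 : adjointAction (k := k) *
        compAntipode (compAntipode (toConv (LinearMap.mul k H).flip)) =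
        convOfAlgHom (Algebra.lmul k H) := by
      rw [adjointAction, mul_assoc]
      convert mul_one _
      ext h x
      rw [(ℛ k h).convMul_apply]
      simp only [LinearMap.sum_apply, Module.End.mul_apply]
      simp [mul_assoc, ← Finset.mul_sum, sum_antipode_left_antipode_antipode_right]
    have h2 := congr(f ($h1 y x))
    rw [(ℛ k y).convMul_apply] at h2
    simp only [LinearMap.sum_apply, Module.End.mul_apply, map_sum, hf] at h2
    simp only [convOfAlgHom_apply, Algebra.coe_lmul_eq_mul, LinearMap.mul_apply'] at h2
    have h3 := congr(f (x * antipode k (antipode k $(sum_counit_smul (ℛ k y)))))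
    simp only [map_sum, Finset.mul_sum, map_smul, mul_smul_comm, smul_eq_mul] at h3
    rw [← h2, ← h3]
    rfl
  · intro hf h x
    rw [adjointAction_apply (ℛ k h), map_sum]
    simp_rw [mul_assoc]
    rw [Finset.sum_congr rfl fun i _ ↦ hf _ _]
    simp_rw [mul_assoc]
    rw [← map_sum, ← Finset.mul_sum, sum_antipode_right_antipode_antipode_left]
    simp

@[simp] lemma contractRight_smul_left (t : H ⊗[k] H) (f : Module.Dual k H) (x y : H) :
    contractRight k ((x ⊗ₜ 1) * t * (y ⊗ₜ 1)) f = x * contractRight k t f * y := by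
  induction t with
  | zero => simp
  | add s t hs ht => simp only [mul_add, add_mul, contractRight_add, hs, ht]
  | tmul p q => simp

lemma contractRight_mul_right (t : H ⊗[k] H) (f : Module.Dual k H) (x y : H) :
    contractRight k ((1 ⊗ₜ x) * t * (1 ⊗ₜ y)) f =
      contractRight k t (f ∘ₗ LinearMap.mulLeft k x ∘ₗ LinearMap.mulRight k y) := by
  induction t with
  | zero => simp
  | add s t hs ht => simp only [mul_add, add_mul, contractRight_add, hs, ht]
  | tmul p q => simp [mul_assoc]

/-- In the convolution algebra `Δ` is the product of two invertible legs, so `b` commuting with `Δ`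
can be rearranged into equality of two conjugates of `b`. -/
lemma antipode_leg1_conj {b : H ⊗[k] H} (hb : ∀ h : H, Commute b (comul (R := k) h)) :
    compAntipode (convOfAlgHom (leg1 k H)) * convConst b * convOfAlgHom (leg1 k H) =
      convOfAlgHom (leg2 k H) * convConst b * compAntipode (convOfAlgHom (leg2 k H)) := by
  have h1 : convConst b * convOfAlgHom (Bialgebra.comulAlgHom k H) =
      convOfAlgHom (Bialgebra.comulAlgHom k H) * convConst b := by
    refine WithConv.ext (LinearMap.ext fun h ↦ ?_)
    rw [convConst_mul_apply, mul_convConst_apply]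
    exact hb h
  have h2 : convOfAlgHom (leg1 k H) =
      convOfAlgHom (Bialgebra.comulAlgHom k H) * compAntipode (convOfAlgHom (leg2 k H)) := by
    rw [← leg1_mul_leg2, mul_assoc, convOfAlgHom_mul_compAntipode, mul_one]
  have h3 : compAntipode (convOfAlgHom (leg1 k H)) *
      convOfAlgHom (Bialgebra.comulAlgHom k H) = convOfAlgHom (leg2 k H) := by
    rw [← leg1_mul_leg2, ← mul_assoc, compAntipode_mul_convOfAlgHom, one_mul]
  calc _ = compAntipode (convOfAlgHom (leg1 k H)) * convConst b *
        (convOfAlgHom (Bialgebra.comulAlgHom k H) * compAntipode (convOfAlgHom (leg2 k H))) := by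
        rw [← h2]
    _ = compAntipode (convOfAlgHom (leg1 k H)) * convOfAlgHom (Bialgebra.comulAlgHom k H) *
        convConst b * compAntipode (convOfAlgHom (leg2 k H)) := by
        rw [mul_assoc, ← mul_assoc (convConst b), h1]
        simp only [mul_assoc]
    _ = _ := by rw [h3]

/-- `S(h₁) Φ(f) h₂ = Φ(h · f)` for the coadjoint action `·`. -/
lemma antipode_conj_contractRight {b : H ⊗[k] H} (hb : ∀ h : H, Commute b (comul (R := k) h))
    (f : Module.Dual k H) (h : H) :
    (compAntipode (convOfAlgHom (AlgHom.id k H)) * convConst (contractRight k b f) *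
      convOfAlgHom (AlgHom.id k H) : ConvHom k H H) h =
      contractRight k b (f ∘ₗ adjointAction (k := k) h) := by
  have h1 := congr(contractRight k ($(antipode_leg1_conj hb) h) f)
  rw [(ℛ k h).convMul_apply, (ℛ k h).convMul_apply, contractRight_sum, contractRight_sum] at h1
  simp only [mul_convConst_apply, convOfAlgHom_apply, compAntipode_apply, leg1_apply, leg2_apply,
    contractRight_smul_left, contractRight_mul_right] at h1
  rw [(ℛ k h).convMul_apply]
  simp only [mul_convConst_apply, convOfAlgHom_apply, compAntipode_apply, AlgHom.id_apply]
  rw [h1, ← map_sum]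
  congr 1
  ext x
  simp [adjointAction_apply (ℛ k h), mul_assoc]

/-- An element `z` is central exactly when `S(h₁) z h₂ = ε(h) z` for all `h`. For `z = Φ f`,
injectivity of `Φ` turns this into invariance of `f` under the adjoint action. -/
lemma IsFactorizable.forall_commute_iff (hR : IsFactorizable k R) (f : Module.Dual k H) :
    (∀ h, Commute (drinfeldMap k R f) h) ↔
      ∀ y x, f (y * x) = f (x * antipode k (antipode k y)) := by
  rw [← forall_adjointAction_iff]
  have key := antipode_conj_contractRight hR.commute_comul f
  set z := contractRight k (switch k R * R) f with hz
  set A : ConvHom k H H := convOfAlgHom (AlgHom.id k H)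
  change (∀ h, Commute z h) ↔ _
  constructor
  · intro hf h
    have h1 : convConst z * A = A * convConst z := by
      refine WithConv.ext (LinearMap.ext fun h ↦ ?_)
      rw [convConst_mul_apply, mul_convConst_apply]
      exact hf h
    rw [mul_assoc, h1, ← mul_assoc, compAntipode_mul_convOfAlgHom, one_mul] at key
    have h2 := key h
    rw [convConst_apply, hz, ← map_smul] at h2
    intro x
    have h3 := congr($(hR.bijective_drinfeldMap.1 h2) x)
    simpa using h3.symm
  · intro hf h
    have h1 : compAntipode A * convConst z * A = convConst z := by
      refine WithConv.ext (LinearMap.ext fun h ↦ ?_)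
      rw [key, convConst_apply, hz, ← map_smul]
      congr 1
      ext x
      simpa using hf h x
    have h2 : A * convConst z = convConst z * A := by
      conv_lhs => rw [← h1, mul_assoc, ← mul_assoc A, convOfAlgHom_mul_compAntipode, one_mul]
    have h3 := congr($h2 h)
    rw [convConst_mul_apply, mul_convConst_apply] at h3
    exact h3.symm

lemma IsQuasitriangular.lTensor_comul_switch_mul (hR : IsQuasitriangular k R) :
    (comul (R := k) (A := H)).lTensor H (switch k R * R) =
      leg12 k (switch k R) * leg13 k (switch k R * R) * leg12 k R := by
  let D : H ⊗[k] H →ₐ[k] H ⊗[k] (H ⊗[k] H) :=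
    Algebra.TensorProduct.map (AlgHom.id k H) (Bialgebra.comulAlgHom k H)
  -- The cyclic permutation moving the last leg to the front converts the first hexagon identity
  -- into a formula for `(id ⊗ Δ)(τ(R))`.
  let C : H ⊗[k] (H ⊗[k] H) →ₐ[k] H ⊗[k] (H ⊗[k] H) :=
    (Algebra.TensorProduct.comm k (H ⊗[k] H) H).toAlgHom.comp
      (Algebra.TensorProduct.assoc k k k H H H).symm.toAlgHom
  have hC : ∀ x y z : H, C (x ⊗ₜ (y ⊗ₜ z)) = z ⊗ₜ (x ⊗ₜ y) := fun x y z ↦ by simp [C]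
  have h1 : ∀ t, D (switch k t) =
      C (TensorProduct.assoc k H H H ((comul (R := k) (A := H)).rTensor H t)) := by
    intro t
    induction t with
    | zero => simp
    | add s t hs ht => simp only [map_add, hs, ht]
    | tmul x y =>
      rw [assoc_rTensor_comul_tmul, map_sum]
      simp only [hC]
      rw [← TensorProduct.tmul_sum, (ℛ k x).eq]
      simp [D]
  have h2 : ∀ t, C (leg13 k t) = leg12 k (switch k t) := by
    intro t
    induction t with
    | zero => simp
    | add s t hs ht => simp only [map_add, hs, ht]
    | tmul x y => simp [hC]
  have h3 : ∀ t, C (leg23 k t) = leg13 k (switch k t) := by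
    intro t
    induction t with
    | zero => simp
    | add s t hs ht => simp only [map_add, hs, ht]
    | tmul x y => simp [hC]
  have h4 : D (switch k R) = leg12 k (switch k R) * leg13 k (switch k R) := by
    rw [h1, hR.comul_rTensor, map_mul, h2, h3]
  have h5 : D R = leg13 k R * leg12 k R := hR.comul_lTensor
  change D (switch k R * R) = _
  rw [map_mul, h4, h5, map_mul]
  simp only [mul_assoc]

/-- Contracting `τ(R)₁₂ (τ(R)R)₁₃ R₁₂` with `f ⊗ g` places `Φ g` between the left legs of `τ(R)` and
`R`. Centrality lets it move to the right. -/
lemma IsQuasitriangular.drinfeldMap_dualMul (hR : IsQuasitriangular k R) (f g : Module.Dual k H)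
    (hg : ∀ h, Commute (drinfeldMap k R g) h) :
    drinfeldMap k R (dualMul f g) = drinfeldMap k R f * drinfeldMap k R g := by
  let C : H ⊗[k] (H ⊗[k] H) →ₗ[k] H :=
    (TensorProduct.rid k H).toLinearMap ∘ₗ
      (LinearMap.mul' k k ∘ₗ TensorProduct.map f g).lTensor H
  have hC : ∀ x y z : H, C (x ⊗ₜ (y ⊗ₜ z)) = (f y * g z) • x := fun x y z ↦ by simp [C]
  have h1 : ∀ t, C ((comul (R := k) (A := H)).lTensor H t) = contractRight k t (dualMul f g) := by
    intro t
    induction t with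
    | zero => simp
    | add s t hs ht => simp only [map_add, contractRight_add, hs, ht]
    | tmul x y => simp [C, dualMul_apply_map]
  have h2 : ∀ p q u p' q', C (leg12 k (p ⊗ₜ q) * leg13 k u * leg12 k (p' ⊗ₜ q')) =
      f (q * q') • (p * contractRight k u g * p') := by
    intro p q u p' q'
    induction u with
    | zero => simp
    | add s t hs ht =>
      simp only [map_add, mul_add, add_mul, contractRight_add, hs, ht, smul_add]
    | tmul x y => simp [hC, smul_smul]
  have h3 : ∀ s t, C (leg12 k s * leg13 k (switch k R * R) * leg12 k t) =
      contractRight k (s * t) f * drinfeldMap k R g := by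
    intro s t
    induction s with
    | zero => simp
    | add s s' hs hs' => simp only [map_add, add_mul, contractRight_add, hs, hs']
    | tmul p q =>
      induction t with
      | zero => simp
      | add s s' hs hs' => simp only [map_add, mul_add, add_mul, contractRight_add, hs, hs']
      | tmul p' q' =>
        rw [h2]
        change _ • (p * drinfeldMap k R g * p') = _
        rw [mul_assoc, (hg p').eq]
        simp [mul_assoc]
  rw [drinfeldMap, ← h1, hR.lTensor_comul_switch_mul, h3]
  rfl

lemma IsQuasitriangular.counit_drinfeldMap (hR : IsQuasitriangular k R) (f : Module.Dual k H) :
    counit (R := k) (drinfeldMap k R f) = f 1 := by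
  have h1 : ∀ t, counit (R := k) (contractRight k t f) = f (counitLeft k H t) := by
    intro t
    induction t with
    | zero => simp
    | add s t hs ht => simp only [map_add, contractRight_add, hs, ht]
    | tmul x y => simp [mul_comm]
  rw [drinfeldMap, h1, map_mul, counitLeft_switch, hR.counitLeft_eq_one, hR.counitRight_eq_one,
    one_mul]

end DrinfeldMap

/-! ### Integrals in `H` and in its dual, and `S⁴ = id` -/

section Integrals

open Coalgebra WithConv

variable {k H : Type*} [Field k] [Ring H] [HopfAlgebra k H] {R : H ⊗[k] H}

variable (k) in
/-- A left integral on which the counit is `1`. -/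
structure IsNormalizedIntegral (Λ : H) : Prop where
  mul_eq : ∀ h, h * Λ = counit (R := k) h • Λ
  counit_eq_one : counit (R := k) Λ = 1

variable (k H) in
-- Semisimplicity gives the augmentation ideal a complementary left ideal, and `Λ` is the component
-- of `1` there. The element `h Λ - ε(h) Λ` lies in both ideals, hence vanishes.
lemma exists_isNormalizedIntegral [IsSemisimpleRing H] :
    ∃ Λ : H, IsNormalizedIntegral k Λ := by
  let I : Ideal H := RingHom.ker (Bialgebra.counitAlgHom k H)
  have hI : ∀ x, x ∈ I ↔ counit (R := k) x = 0 := fun x ↦ Iff.rfl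
  obtain ⟨J, hJ⟩ := exists_isCompl I
  obtain ⟨a, ha, Λ, hΛ, h1⟩ := Submodule.mem_sup.mp
    (hJ.sup_eq_top ▸ Submodule.mem_top : (1 : H) ∈ I ⊔ J)
  have hε : counit (R := k) Λ = 1 := by
    have := congrArg (counit (R := k)) h1
    rwa [map_add, (hI a).mp ha, zero_add, Bialgebra.counit_one] at this
  refine ⟨Λ, fun h ↦ ?_, hε⟩
  have h2 : h * Λ - counit (R := k) h • Λ ∈ I ⊓ J := by
    refine ⟨?_, J.sub_mem (J.mul_mem_left h hΛ) ?_⟩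
    · rw [SetLike.mem_coe, hI, map_sub, Bialgebra.counit_mul, map_smul, smul_eq_mul, sub_self]
    · rw [← one_mul Λ, ← smul_mul_assoc]
      exact J.mul_mem_left _ hΛ
  rw [hJ.inf_eq_bot] at h2
  exact sub_eq_zero.mp h2

lemma IsNormalizedIntegral.antipode_eq {Λ : H} (hΛ : IsNormalizedIntegral k Λ)
    (hS : Function.Surjective (antipode k (A := H))) : antipode k Λ = Λ := by
  have h1 : ∀ h, antipode k Λ * h = counit (R := k) h • antipode k Λ := by
    intro h
    obtain ⟨h, rfl⟩ := hS h
    rw [← antipode_mul_antidistrib, hΛ.mul_eq, map_smul, counit_antipode]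
  have h2 := h1 Λ
  rw [hΛ.mul_eq, counit_antipode, hΛ.counit_eq_one, one_smul, one_smul] at h2
  exact h2.symm

lemma IsNormalizedIntegral.mul_eq_right {Λ : H} (hΛ : IsNormalizedIntegral k Λ)
    (hS : Function.Surjective (antipode k (A := H))) (h : H) :
    Λ * h = counit (R := k) h • Λ := by
  obtain ⟨h, rfl⟩ := hS h
  conv_lhs => rw [← hΛ.antipode_eq hS]
  rw [← antipode_mul_antidistrib, hΛ.mul_eq, map_smul, counit_antipode, hΛ.antipode_eq hS]

lemma dualMul_comp_antipode (f g : Module.Dual k H) :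
    dualMul (f ∘ₗ antipode k) (g ∘ₗ antipode k) = dualMul g f ∘ₗ antipode k := by
  ext h
  rw [dualMul_apply (ℛ k h), LinearMap.comp_apply, dualMul_apply_map, comul_antipode]
  conv_rhs => rw [← (ℛ k h).eq]
  simp [mul_comm]

/-- A normalized two-sided integral in the dual, with the symmetry properties it has for
factorizable Hopf algebras. -/
structure IsTwistedHaar (l : Module.Dual k H) : Prop where
  map_one : l 1 = 1
  dualMul_left : ∀ f, dualMul f l = f 1 • l
  dualMul_right : ∀ f, dualMul l f = f 1 • l
  comp_antipode : l ∘ₗ antipode k = l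
  map_mul : ∀ y x, l (y * x) = l (x * antipode k (antipode k y))

lemma IsFactorizable.isTwistedHaar (hR : IsFactorizable k R) {Λ : H}
    (hΛ : IsNormalizedIntegral k Λ) {l : Module.Dual k H} (hl : drinfeldMap k R l = Λ) :
    IsTwistedHaar l := by
  have hS := hR.surjective_antipode
  have hc : ∀ h, Commute (drinfeldMap k R l) h := by
    intro h
    rw [hl, Commute, SemiconjBy, hΛ.mul_eq, hΛ.mul_eq_right hS]
  have h1 : l 1 = 1 := by
    rw [← hR.counit_drinfeldMap, hl, hΛ.counit_eq_one]
  have hleft : ∀ f, dualMul f l = f 1 • l := by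
    intro f
    apply hR.bijective_drinfeldMap.1
    rw [hR.drinfeldMap_dualMul f l hc, hl, hΛ.mul_eq, hR.counit_drinfeldMap, map_smul, hl]
  have hright : ∀ f, dualMul (l ∘ₗ antipode k) f = f 1 • (l ∘ₗ antipode k) := by
    intro f
    let e := LinearEquiv.ofBijective (antipode k (A := H)) hR.bijective_antipode
    obtain ⟨g, rfl⟩ : ∃ g : Module.Dual k H, f = g ∘ₗ antipode k := by
      refine ⟨f ∘ₗ e.symm.toLinearMap, ?_⟩
      ext x
      exact congrArg f (e.symm_apply_apply x).symm
    rw [dualMul_comp_antipode, hleft]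
    simp [LinearMap.smul_comp]
  -- The product `(l ∘ S) l` equals `l` because `l` is a left integral, and `l ∘ S` because `l ∘ S`
  -- is a right integral.
  have hS : l ∘ₗ antipode k = l := by
    have h2 := hleft (l ∘ₗ antipode k)
    rw [hright] at h2
    simpa [h1] using h2
  rw [hS] at hright
  exact ⟨h1, hleft, hright, hS, (hR.forall_commute_iff l).mp hc⟩

variable (k) in
/-- The contraction `x ⊗ y ↦ f(x) y`. -/
noncomputable def contractLeft (f : Module.Dual k H) : H ⊗[k] H →ₗ[k] H :=
  (TensorProduct.lid k H).toLinearMap ∘ₗ f.rTensor H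

@[simp] lemma contractLeft_tmul (f : Module.Dual k H) (x y : H) :
    contractLeft k f (x ⊗ₜ y) = f x • y := by
  simp [contractLeft]

/-- The map `x ↦ f(x₁) x₂`. -/
noncomputable def hit (f : Module.Dual k H) : Module.End k H :=
  contractLeft k f ∘ₗ comul

lemma hit_apply {ι : Type*} {h : H} (r : Repr k h ι) (f : Module.Dual k H) :
    hit f h = ∑ i ∈ r.index, f (r.left i) • r.right i := by
  rw [hit, LinearMap.comp_apply, ← r.eq]
  simp

lemma apply_hit (f g : Module.Dual k H) (h : H) : g (hit f h) = dualMul f g h := by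
  rw [hit_apply (ℛ k h), dualMul_apply (ℛ k h)]
  simp

lemma eq_of_forall_dual {x y : H} (h : ∀ f : Module.Dual k H, f x = f y) : x = y := by
  rw [← sub_eq_zero, ← Module.forall_dual_apply_eq_zero_iff k]
  intro f
  rw [map_sub, h, sub_self]

lemma hit_mul_hit (f g : Module.Dual k H) : hit f * hit g = hit (dualMul g f) := by
  ext h
  refine eq_of_forall_dual (k := k) fun φ ↦ ?_
  rw [Module.End.mul_apply, apply_hit, apply_hit, apply_hit, dualMul_assoc]

lemma hit_counit : hit (counit (R := k) (A := H)) = 1 := by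
  ext h
  refine eq_of_forall_dual (k := k) fun φ ↦ ?_
  rw [apply_hit, counit_dualMul, Module.End.one_apply]

lemma hit_smul (c : k) (f : Module.Dual k H) : hit (c • f) = c • hit f := by
  ext h
  refine eq_of_forall_dual (k := k) fun φ ↦ ?_
  rw [apply_hit, smul_dualMul]
  simp [apply_hit]

lemma hit_sum {ι : Type*} (s : Finset ι) (f : ι → Module.Dual k H) :
    hit (∑ i ∈ s, f i) = ∑ i ∈ s, hit (f i) := by
  ext h
  refine eq_of_forall_dual (k := k) fun φ ↦ ?_
  rw [apply_hit, sum_dualMul]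
  simp [apply_hit]

lemma hit_comp_mulRight (f : Module.Dual k H) (e y : H) :
    hit (f ∘ₗ LinearMap.mulRight k e) y = contractLeft k f (comul y * (e ⊗ₜ 1)) := by
  rw [hit, LinearMap.comp_apply]
  induction comul (R := k) y with
  | zero => simp
  | add s t hs ht => simp only [map_add, add_mul, hs, ht]
  | tmul p q => simp

/-- This is the image under `S ⊗ S` of `∑ (x₁ ⊗ 1) τ(Δ(S(x₂))) = 1 ⊗ S(x)`, which follows by
inverting `τ ∘ Δ` as a product of legs. -/
lemma sum_comul_antipode_antipode_mul (x : H) :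
    ∑ i ∈ (ℛ k x).index, comul (R := k) (antipode k (antipode k ((ℛ k x).right i))) *
      (antipode k ((ℛ k x).left i) ⊗ₜ[k] 1) = 1 ⊗ₜ antipode k (antipode k x) := by
  have h1 : convOfAlgHom (leg1 k H) * (compAntipode
      (convOfAlgHom ((switch k).toAlgHom.comp (Bialgebra.comulAlgHom k H)))) =
      compAntipode (convOfAlgHom (leg2 k H)) := by
    have h2 : compAntipode
        (convOfAlgHom ((switch k).toAlgHom.comp (Bialgebra.comulAlgHom k H))) =
        compAntipode (convOfAlgHom (leg1 k H)) * compAntipode (convOfAlgHom (leg2 k H)) := by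
      refine left_inv_eq_right_inv (compAntipode_mul_convOfAlgHom _) ?_
      rw [← leg2_mul_leg1, mul_assoc, ← mul_assoc (convOfAlgHom (leg1 k H))]
      simp
    rw [h2, ← mul_assoc, convOfAlgHom_mul_compAntipode, one_mul]
  have h3 := congr(antipodeTensor k H ($h1 x))
  rw [(ℛ k x).convMul_apply, map_sum] at h3
  simp only [antipodeTensor_mul] at h3
  simp only [compAntipode_apply, convOfAlgHom_apply, leg1_apply, leg2_apply,
    antipodeTensor_tmul, antipode_one] at h3
  rw [← h3]
  refine Finset.sum_congr rfl fun i _ ↦ ?_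
  rw [comul_antipode (antipode k _)]
  rfl

variable (k H) in
/-- The linear form `h ↦ Tr(x ↦ h S²(x))`. -/
noncomputable def twistedTrace : Module.Dual k H :=
  LinearMap.trace k H ∘ₗ LinearMap.lcomp k H (antipode k ∘ₗ antipode k) ∘ₗ LinearMap.mul k H

lemma twistedTrace_apply (h : H) :
    twistedTrace k H h =
      LinearMap.trace k H (LinearMap.mulLeft k h ∘ₗ antipode k ∘ₗ antipode k) := rfl

/-- With a basis `e_i`, the value of the left side at `h` is the trace of `∑ hit (g i) M hit (s i)`,
where `g i = f(· e_i)`, `s i = e^i ∘ S` and `M = L_h S²`. Cycling the factors leaves `∑ hit (s i)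
hit (g i)`, which is `f(1) id` because `f(y₁ S(y₂)) = ε(y) f(1)`. -/
lemma dualMul_twistedTrace [Module.Finite k H] (f : Module.Dual k H) :
    dualMul f (twistedTrace k H) = f 1 • twistedTrace k H := by
  ext h
  let e := Module.finBasis k H
  let M : Module.End k H := LinearMap.mulLeft k h ∘ₗ antipode k ∘ₗ antipode k
  let g : Fin (Module.finrank k H) → Module.Dual k H := fun i ↦ f ∘ₗ LinearMap.mulRight k (e i)
  let s : Fin (Module.finrank k H) → Module.Dual k H := fun i ↦ e.coord i ∘ₗ antipode k
  have h1 : dualMul f (twistedTrace k H) h =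
      LinearMap.trace k H (∑ i, hit (g i) * M * hit (s i)) := by
    rw [dualMul_apply (ℛ k h)]
    have h0 : ∀ c y, c * twistedTrace k H y = LinearMap.trace k H
        (c • (LinearMap.mulLeft k y ∘ₗ antipode k ∘ₗ antipode k)) := by
      intro c y
      rw [map_smul, smul_eq_mul, twistedTrace_apply]
    simp only [h0, ← map_sum]
    congr 1
    ext x
    have h2 : ∀ y z, ∑ i, e.coord i y • contractLeft k f (comul z * (e i ⊗ₜ 1)) =
        contractLeft k f (comul z * (y ⊗ₜ 1)) := by
      intro y z
      conv_rhs => rw [← e.sum_repr y]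
      simp only [TensorProduct.sum_tmul, Finset.mul_sum, map_sum, ← TensorProduct.smul_tmul',
        mul_smul_comm, map_smul]
      rfl
    have h3 : ∀ i, (hit (g i) * M * hit (s i)) x = ∑ j ∈ (ℛ k x).index,
        e.coord i (antipode k ((ℛ k x).left j)) • contractLeft k f
          (comul (h * antipode k (antipode k ((ℛ k x).right j))) * (e i ⊗ₜ 1)) := by
      intro i
      simp only [Module.End.mul_apply]
      rw [hit_apply (ℛ k x)]
      simp only [map_sum, map_smul, g, hit_comp_mulRight]
      rfl
    rw [LinearMap.sum_apply, LinearMap.sum_apply]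
    simp only [h3]
    rw [Finset.sum_comm]
    simp only [h2]
    simp only [Bialgebra.comul_mul, mul_assoc]
    rw [← map_sum, ← Finset.mul_sum, sum_comul_antipode_antipode_mul, ← (ℛ k h).eq]
    simp [Finset.sum_mul]
  have h4 : ∑ i, hit (s i) * hit (g i) = f 1 • 1 := by
    simp only [hit_mul_hit]
    rw [← hit_sum, ← hit_counit, ← hit_smul]
    congr 1
    ext y
    rw [LinearMap.sum_apply]
    simp only [dualMul_apply (ℛ k y)]
    rw [Finset.sum_comm]
    have h5 : ∀ a b : H, ∑ i, g i a * s i b = f (a * antipode k b) := by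
      intro a b
      have h6 := congr(f (a * $(e.sum_repr (antipode k b))))
      simp only [Finset.mul_sum, map_sum, mul_smul_comm, map_smul, smul_eq_mul] at h6
      rw [← h6]
      exact Finset.sum_congr rfl fun i _ ↦ mul_comm _ _
    simp only [h5]
    rw [← map_sum, sum_mul_antipode_eq_smul]
    simp [mul_comm]
  rw [h1, map_sum]
  simp_rw [LinearMap.trace_mul_cycle k (hit (g _)) M, ← map_sum, ← Finset.sum_mul]
  rw [h4]
  simp [M, twistedTrace_apply]

/-- The product of `l` with the twisted trace is evaluated twice, using that the trace is a left
integral and `l` a right one. -/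
lemma IsTwistedHaar.twistedTrace_eq [Module.Finite k H] {l : Module.Dual k H}
    (hl : IsTwistedHaar l) :
    twistedTrace k H = twistedTrace k H 1 • l := by
  have h1 := dualMul_twistedTrace l
  rw [hl.dualMul_right, hl.map_one, one_smul] at h1
  exact h1.symm

lemma IsNormalizedIntegral.twistedTrace_eq_one [Module.Finite k H] {Λ : H}
    (hΛ : IsNormalizedIntegral k Λ) (hS : Function.Surjective (antipode k (A := H))) :
    twistedTrace k H Λ = 1 := by
  have h1 : LinearMap.mulLeft k Λ ∘ₗ antipode k ∘ₗ antipode k =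
      (counit (R := k)).smulRight Λ := by
    ext x
    simp [hΛ.mul_eq_right hS]
  rw [twistedTrace_apply, h1, LinearMap.trace_smulRight, hΛ.counit_eq_one]

/-- Cancel the first leg of `Δ(h)` by its convolution inverse in `Δ(h) Δ(Λ) = ε(h) Δ(Λ)`. -/
lemma one_tmul_mul_comul_integral {Λ : H} (hΛ : IsNormalizedIntegral k Λ) (h : H) :
    (1 ⊗ₜ h) * comul (R := k) Λ = (antipode k h ⊗ₜ 1) * comul (R := k) Λ := by
  have h1 : convOfAlgHom (leg2 k H) * convConst (comul (R := k) Λ) =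
      compAntipode (convOfAlgHom (leg1 k H)) * convConst (comul (R := k) Λ) := by
    have h2 : convOfAlgHom (Bialgebra.comulAlgHom k H) * convConst (comul (R := k) Λ) =
        convConst (comul (R := k) Λ) := by
      refine WithConv.ext (LinearMap.ext fun h ↦ ?_)
      rw [mul_convConst_apply, convConst_apply, convOfAlgHom_apply, Bialgebra.comulAlgHom_apply,
        ← Bialgebra.comul_mul, hΛ.mul_eq, map_smul]
    conv_rhs => rw [← h2]
    rw [← leg1_mul_leg2, ← mul_assoc, ← mul_assoc, compAntipode_mul_convOfAlgHom, one_mul]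
  have h3 := congr($h1 h)
  rw [mul_convConst_apply, mul_convConst_apply] at h3
  exact h3

lemma IsTwistedHaar.contractRight_comul {l : Module.Dual k H} (hl : IsTwistedHaar l) (x : H) :
    contractRight k (comul x) l = l x • 1 := by
  refine eq_of_forall_dual (k := k) fun φ ↦ ?_
  have h1 := congr($(hl.dualMul_left φ) x)
  rw [dualMul_apply (ℛ k x)] at h1
  rw [← (ℛ k x).eq, contractRight_sum]
  simpa [mul_comm] using h1

/-- The integral in the dual is nondegenerate. -/
lemma IsTwistedHaar.eq_zero {l : Module.Dual k H} (hl : IsTwistedHaar l) {Λ : H}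
    (hΛ : IsNormalizedIntegral k Λ) (hlΛ : l Λ ≠ 0)
    (hS : Function.Injective (antipode k (A := H))) {h : H} (h0 : ∀ x, l (h * x) = 0) : h = 0 := by
  -- Applying `id ⊗ l` to `(1 ⊗ h) Δ(Λ) = (S(h) ⊗ 1) Δ(Λ)` gives `0` on the left and `l(Λ) S(h)` on
  -- the right.
  have h1 := congr(contractRight k $(one_tmul_mul_comul_integral hΛ h) l)
  have h2 := contractRight_mul_right (comul Λ) l h 1
  have h3 := contractRight_smul_left (comul Λ) l (antipode k h) 1
  have h4 : l ∘ₗ LinearMap.mulLeft k h ∘ₗ LinearMap.mulRight k 1 = 0 := by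
    ext x
    simp [h0]
  rw [← Algebra.TensorProduct.one_def, mul_one] at h2 h3
  rw [h2, h3, h4, map_zero, hl.contractRight_comul, mul_one, mul_smul_comm, mul_one, eq_comm,
    smul_eq_zero_iff_right hlΛ] at h1
  exact hS (by rw [h1, map_zero])

lemma IsTwistedHaar.antipode_pow_four {l : Module.Dual k H} (hl : IsTwistedHaar l) {Λ : H}
    (hΛ : IsNormalizedIntegral k Λ) (hlΛ : l Λ ≠ 0)
    (hS : Function.Injective (antipode k (A := H))) (h : H) :
    antipode k (antipode k (antipode k (antipode k h))) = h := by
  have hlS : ∀ x, l (antipode k x) = l x := fun x ↦ congr($(hl.comp_antipode) x)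
  -- Combining twisted symmetry with `l ∘ S = l` gives `l(a S⁴(b)) = l(S²(b) a) = l(S(a) S³(b)) =
  -- l(S³(b) S³(a)) = l(S³(a b)) = l(a b)`.
  have h1 : ∀ a b, l (a * b) = l (a * antipode k (antipode k (antipode k (antipode k b)))) := by
    intro a b
    rw [← hl.map_mul (antipode k (antipode k b)) a, ← hlS, antipode_mul_antidistrib,
      hl.map_mul, ← antipode_mul_antidistrib, hlS]
  rw [eq_comm, ← sub_eq_zero]
  refine hl.eq_zero hΛ hlΛ hS fun x ↦ ?_
  rw [hl.map_mul, map_sub, map_sub, mul_sub, map_sub, sub_eq_zero, h1]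

end Integrals

/-! ### Traces of `S²` and the Larson–Radford argument -/

section AntipodeSquared

open Coalgebra WithConv

lemma exists_natCast_eq_trace {k V : Type*} [Field k] [AddCommGroup V] [Module k V]
    [Module.Finite k V] {P : Module.End k V} (hP : IsIdempotentElem P) :
    ∃ m : ℕ, LinearMap.trace k V P = m :=
  ⟨_, (LinearMap.IsIdempotentElem.isProj_range P hP).trace⟩

/-- The operator is the difference of the idempotents `(X² ± X)/2`, whose traces are ranks. -/
lemma exists_intCast_eq_trace {k V : Type*} [Field k] [CharZero k] [AddCommGroup V] [Module k V]
    [Module.Finite k V] {X : Module.End k V} (hX : X * X * X = X) :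
    ∃ m : ℤ, LinearMap.trace k V X = m := by
  have hP : IsIdempotentElem ((2 : k)⁻¹ • (X * X + X)) := by
    rw [IsIdempotentElem, smul_mul_smul_comm,
      show (X * X + X) * (X * X + X) = (2 : k) • (X * X + X) by
        simp only [mul_add, add_mul, ← mul_assoc, hX, two_smul]; abel, smul_smul]
    congr 1
    norm_num
  have hQ : IsIdempotentElem ((2 : k)⁻¹ • (X * X - X)) := by
    rw [IsIdempotentElem, smul_mul_smul_comm,
      show (X * X - X) * (X * X - X) = (2 : k) • (X * X - X) by
        simp only [mul_sub, sub_mul, ← mul_assoc, hX, two_smul]; abel, smul_smul]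
    congr 1
    norm_num
  obtain ⟨a, ha⟩ := exists_natCast_eq_trace hP
  obtain ⟨b, hb⟩ := exists_natCast_eq_trace hQ
  refine ⟨a - b, ?_⟩
  push_cast
  rw [← ha, ← hb]
  simp only [map_smul, map_add, map_sub, smul_eq_mul]
  ring

/-- The eigenspaces for `1` and `-1` have dimensions `a` and `b` with `a + b = n` and `a - b = n m`.
As `m ≠ 0`, one of them is zero, and the fixed vector `v` excludes `a = 0`. -/
lemma eq_one_of_mul_self_eq_one {k V : Type*} [Field k] [CharZero k] [AddCommGroup V] [Module k V]
    [Module.Finite k V] {T : Module.End k V} (hT : T * T = 1) {m : ℤ} (hm : m ≠ 0)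
    (htr : LinearMap.trace k V T = Module.finrank k V * m) {v : V} (hv : T v = v) (hv0 : v ≠ 0) :
    T = 1 := by
  have hP : IsIdempotentElem ((2 : k)⁻¹ • (1 + T)) := by
    rw [IsIdempotentElem, smul_mul_smul_comm,
      show (1 + T) * (1 + T) = (2 : k) • (1 + T) by
        simp only [mul_add, add_mul, hT, two_smul, mul_one, one_mul]; abel, smul_smul]
    congr 1
    norm_num
  have hQ : IsIdempotentElem ((2 : k)⁻¹ • (1 - T)) := by
    rw [IsIdempotentElem, smul_mul_smul_comm,
      show (1 - T) * (1 - T) = (2 : k) • (1 - T) by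
        simp only [mul_sub, sub_mul, hT, two_smul, mul_one, one_mul]; abel, smul_smul]
    congr 1
    norm_num
  obtain ⟨a, ha⟩ := exists_natCast_eq_trace hP
  obtain ⟨b, hb⟩ := exists_natCast_eq_trace hQ
  set n := Module.finrank k V
  have hsum : (a : ℤ) + b = n := by
    have : (a : k) + b = n := by
      rw [← ha, ← hb, ← LinearMap.trace_one k V]
      simp only [map_smul, map_add, map_sub, smul_eq_mul]
      ring
    exact_mod_cast this
  have hdiff : (a : ℤ) - b = n * m := by
    have : (a : k) - b = n * m := by
      rw [← ha, ← hb, ← htr]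
      simp only [map_smul, map_add, map_sub, smul_eq_mul]
      ring
    exact_mod_cast this
  have h0 : a = 0 ∨ b = 0 := by
    by_contra! h
    have h1 : (1 : ℤ) ≤ a := by have := h.1; omega
    have h2 : (1 : ℤ) ≤ b := by have := h.2; omega
    rcases lt_or_gt_of_ne hm with h3 | h3 <;> nlinarith
  rcases h0 with rfl | rfl
  · have h1 := (LinearMap.IsIdempotentElem.trace_eq_zero_iff hP).mp (by rw [ha, Nat.cast_zero])
    have h2 := congr($h1 v)
    rw [LinearMap.smul_apply, LinearMap.add_apply, hv, Module.End.one_apply, ← two_smul k,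
      smul_smul] at h2
    norm_num at h2
    exact absurd h2 hv0
  · have h1 := (LinearMap.IsIdempotentElem.trace_eq_zero_iff hQ).mp (by rw [hb, Nat.cast_zero])
    rw [smul_eq_zero_iff_right (by norm_num), sub_eq_zero] at h1
    exact h1.symm

variable {k H : Type*} [Field k] [Ring H] [HopfAlgebra k H] {R : H ⊗[k] H}

variable (k H) in
/-- The character of the regular representation. -/
noncomputable def regularCharacter : Module.Dual k H :=
  LinearMap.trace k H ∘ₗ LinearMap.mul k H

lemma regularCharacter_apply (h : H) :
    regularCharacter k H h = LinearMap.trace k H (LinearMap.mulLeft k h) := rfl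

lemma sum_comul_mul_antipode {ι : Type*} {x : H} (r : Repr k x ι) :
    ∑ i ∈ r.index, comul (r.left i) * (1 ⊗ₜ[k] antipode k (r.right i)) = x ⊗ₜ 1 := by
  have h1 : convOfAlgHom (Bialgebra.comulAlgHom k H) * compAntipode (convOfAlgHom (leg2 k H)) =
      convOfAlgHom (leg1 k H) := by
    rw [← leg1_mul_leg2, mul_assoc, convOfAlgHom_mul_compAntipode, mul_one]
  have h2 := congr($h1 x)
  rw [r.convMul_apply] at h2
  exact h2

/-- The tensor square of the regular representation is a multiple of the regular
representation. -/
lemma dualMul_regularCharacter [Module.Finite k H] :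
    dualMul (regularCharacter k H) (regularCharacter k H) =
      (Module.finrank k H : k) • regularCharacter k H := by
  -- `F` intertwines multiplication by `h ⊗ 1` with multiplication by `Δ(h)`. `G` inverts it, on the
  -- right by computation and on the left by finite dimension.
  let F : Module.End k (H ⊗[k] H) :=
    LinearMap.mul' k (H ⊗[k] H) ∘ₗ TensorProduct.map comul (leg2 k H).toLinearMap
  have hF : ∀ x y, F (x ⊗ₜ y) = comul x * (1 ⊗ₜ y) := fun x y ↦ by simp [F]
  let G : Module.End k (H ⊗[k] H) :=
    (LinearMap.mul' k H ∘ₗ (antipode k (A := H)).rTensor H).lTensor H ∘ₗ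
      (TensorProduct.assoc k H H H).toLinearMap ∘ₗ (comul (R := k) (A := H)).rTensor H
  have hG : ∀ x y, G (x ⊗ₜ y) = ∑ i ∈ (ℛ k x).index,
      (ℛ k x).left i ⊗ₜ (antipode k ((ℛ k x).right i) * y) := by
    intro x y
    rw [LinearMap.comp_apply, LinearMap.comp_apply, LinearEquiv.coe_coe, assoc_rTensor_comul_tmul]
    simp
  have hFG : F * G = 1 := by
    ext x y
    simp only [TensorProduct.AlgebraTensorModule.curry_apply, LinearMap.restrictScalars_self,
      TensorProduct.curry_apply, Module.End.mul_apply, Module.End.one_apply]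
    rw [hG, map_sum]
    have : ∀ p q : H, F (p ⊗ₜ (q * y)) = comul p * (1 ⊗ₜ[k] q) * (1 ⊗ₜ y) := by
      intro p q
      rw [hF, mul_assoc, Algebra.TensorProduct.tmul_mul_tmul, one_mul]
    simp only [this]
    rw [← Finset.sum_mul, sum_comul_mul_antipode]
    simp
  ext h
  have h1 : LinearMap.mulLeft k (comul (R := k) h) * F = F * LinearMap.mulLeft k (h ⊗ₜ 1) := by
    ext x y
    simp [hF, mul_assoc]
  have h2 : ∀ t : H ⊗[k] H, LinearMap.trace k _ (LinearMap.mulLeft k t) =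
      LinearMap.mul' k k (TensorProduct.map (regularCharacter k H) (regularCharacter k H) t) := by
    intro t
    induction t with
    | zero => simp
    | add s t hs ht => rw [map_add, map_add, ← hs, ← ht, ← map_add]; congr 1; ext; simp [add_mul]
    | tmul x y =>
      have : LinearMap.mulLeft k (x ⊗ₜ[k] y) =
          TensorProduct.map (LinearMap.mulLeft k x) (LinearMap.mulLeft k y) := by
        ext; simp
      rw [this, LinearMap.trace_tensorProduct']
      simp [regularCharacter_apply]
  have h3 : LinearMap.mulLeft k (comul (R := k) h) = F * LinearMap.mulLeft k (h ⊗ₜ 1) * G := by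
    rw [← h1, mul_assoc, hFG, mul_one]
  rw [dualMul_apply_map, ← h2, h3, LinearMap.trace_mul_cycle, mul_eq_one_comm.mp hFG, one_mul, h2]
  have h4 : regularCharacter k H 1 = Module.finrank k H := by
    rw [regularCharacter_apply, LinearMap.mulLeft_one, LinearMap.trace_id]
  simp [h4, mul_comm]

lemma IsNormalizedIntegral.regularCharacter_eq_one [Module.Finite k H] {Λ : H}
    (hΛ : IsNormalizedIntegral k Λ) (hS : Function.Surjective (antipode k (A := H))) :
    regularCharacter k H Λ = 1 := by
  have h1 : LinearMap.mulLeft k Λ = (counit (R := k)).smulRight Λ := by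
    ext x
    simp [hΛ.mul_eq_right hS]
  rw [regularCharacter_apply, h1, LinearMap.trace_smulRight, hΛ.counit_eq_one]

/-- Averaging `hit f` over right multiplications by `Λ₁` and `S(Λ₂)` gives the scalar `f(Λ)`. By
cyclicity the averaging can be moved onto `S²`, which it fixes because `S³(Λ₂) Λ₁ = S³(S(Λ₁) Λ₂) =
1` when `S⁴ = id`. -/
lemma trace_hit_mul [Module.Finite k H] {Λ : H} (hΛ : IsNormalizedIntegral k Λ)
    (h4 : ∀ h : H, antipode k (antipode k (antipode k (antipode k h))) = h)
    (f : Module.Dual k H) :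
    LinearMap.trace k H (hit f * (antipode k ∘ₗ antipode k)) =
      f Λ * LinearMap.trace k H (antipode k ∘ₗ antipode k) := by
  let T : Module.End k H := antipode k ∘ₗ antipode k
  have hT : ∀ x, T x = antipode k (antipode k x) := fun _ ↦ rfl
  let r := ℛ k Λ
  have h1 : ∑ i ∈ r.index, LinearMap.mulRight k (antipode k (r.right i)) *
      (hit f * (LinearMap.mulRight k (r.left i) * T)) = f Λ • T := by
    suffices ∀ y, ∑ i ∈ r.index, hit f (y * r.left i) * antipode k (r.right i) = f Λ • y by
      ext x
      simpa using this (T x)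
    intro y
    have h2 : ∀ s : H ⊗[k] H, ∀ z, contractLeft k f s * z = contractLeft k f (s * (1 ⊗ₜ z)) := by
      intro s z
      induction s with
      | zero => simp
      | add s t hs ht => simp only [map_add, add_mul, hs, ht]
      | tmul p q => simp
    simp only [hit, LinearMap.comp_apply, h2, Bialgebra.comul_mul, mul_assoc]
    rw [← map_sum, ← Finset.mul_sum, sum_comul_mul_antipode, ← (ℛ k y).eq, Finset.sum_mul]
    simp only [Algebra.TensorProduct.tmul_mul_tmul, mul_one, map_sum, contractLeft_tmul,
      hΛ.mul_eq, map_smul, smul_eq_mul, mul_comm _ (f Λ), mul_smul]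
    rw [← Finset.smul_sum, sum_counit_smul]
  have h2 : ∑ i ∈ r.index, LinearMap.mulRight k (r.left i) * T *
      LinearMap.mulRight k (antipode k (r.right i)) = T := by
    ext x
    simp only [LinearMap.sum_apply, Module.End.mul_apply, LinearMap.mulRight_apply, hT,
      antipode_mul_antidistrib, mul_assoc]
    have h3 : ∑ i ∈ r.index, antipode k (antipode k (antipode k (r.right i))) * r.left i = 1 := by
      calc _ = ∑ i ∈ r.index, antipode k (antipode k (antipode k
            (antipode k (r.left i) * r.right i))) := by
            refine Finset.sum_congr rfl fun i _ ↦ ?_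
            rw [antipode_mul_antidistrib, antipode_mul_antidistrib, antipode_mul_antidistrib, h4]
        _ = 1 := by
            rw [← map_sum, ← map_sum, ← map_sum, sum_antipode_mul_eq_smul, hΛ.counit_eq_one]
            simp
    rw [← Finset.mul_sum, h3, mul_one]
  change LinearMap.trace k H (hit f * T) = f Λ * LinearMap.trace k H T
  rw [← smul_eq_mul (f Λ), ← map_smul, ← h1, map_sum]
  conv_lhs => rw [← h2, Finset.mul_sum, map_sum]
  refine Finset.sum_congr rfl fun i _ ↦ ?_
  rw [LinearMap.trace_mul_comm k (LinearMap.mulRight k _)]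
  simp only [mul_assoc]

/-- The **Larson–Radford theorem** for Hopf algebras with normalized integrals on both sides. -/
lemma antipode_antipode_of_integrals [CharZero k] [Module.Finite k H] {Λ : H}
    (hΛ : IsNormalizedIntegral k Λ)
    (hS : Function.Surjective (antipode k (A := H)))
    (h4 : ∀ h : H, antipode k (antipode k (antipode k (antipode k h))) = h)
    (htr : LinearMap.trace k H (antipode k ∘ₗ antipode k) ≠ 0) (h : H) :
    antipode k (antipode k h) = h := by
  let T : Module.End k H := antipode k ∘ₗ antipode k
  have hT : T * T = 1 := by
    ext x
    exact h4 x
  have h1 : (1 : H) ≠ 0 := by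
    intro h0
    have := congrArg (counit (R := k)) h0
    simp at this
  have hn : (Module.finrank k H : k) ≠ 0 := by
    have : Nontrivial H := ⟨1, 0, h1⟩
    exact_mod_cast (Module.finrank_pos (R := k) (M := H)).ne'
  set χ := regularCharacter k H with hχ
  have hχT : χ ∘ₗ T = χ := by
    ext x
    have : LinearMap.mulLeft k (T x) = T * LinearMap.mulLeft k x * T := by
      ext y
      have := congr($hT y)
      simp only [Module.End.mul_apply, Module.End.one_apply] at this
      simp only [Module.End.mul_apply, LinearMap.mulLeft_apply]
      conv_lhs => rw [← this]
      simp only [T, LinearMap.comp_apply, antipode_mul_antidistrib]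
    rw [LinearMap.comp_apply, hχ, regularCharacter_apply, this, LinearMap.trace_mul_cycle, hT,
      one_mul, regularCharacter_apply]
  have hcomm : hit χ * T = T * hit χ := by
    ext x
    refine eq_of_forall_dual (k := k) fun φ ↦ ?_
    rw [Module.End.mul_apply, Module.End.mul_apply, apply_hit, ← LinearMap.comp_apply φ T,
      apply_hit]
    conv_rhs => rw [← hχT]
    change _ = dualMul ((χ ∘ₗ antipode k) ∘ₗ antipode k) ((φ ∘ₗ antipode k) ∘ₗ antipode k) x
    rw [dualMul_comp_antipode, dualMul_comp_antipode]
    rfl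
  have hE : hit χ * hit χ = (Module.finrank k H : k) • hit χ := by
    rw [hit_mul_hit, dualMul_regularCharacter, hit_smul]
  -- `hit χ / n` is idempotent and commutes with the involution `T`, so the product is equal to its
  -- own cube. Together with `χ(Λ) = 1`, this makes `Tr(T)` an integer multiple of `n`.
  obtain ⟨m, hm⟩ : ∃ m : ℤ, LinearMap.trace k H ((Module.finrank k H : k)⁻¹ • (hit χ * T)) = m := by
    apply exists_intCast_eq_trace
    have h2 : hit χ * T * (hit χ * T) = (Module.finrank k H : k) • hit χ := by
      rw [mul_assoc, ← mul_assoc T, ← hcomm, mul_assoc (hit χ) T T, hT, mul_one, hE]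
    rw [smul_mul_smul_comm, h2, smul_smul, mul_assoc, inv_mul_cancel₀ hn, mul_one,
      smul_mul_smul_comm, ← mul_assoc, hE, smul_mul_assoc, smul_smul, mul_assoc,
      inv_mul_cancel₀ hn, mul_one]
  have htrT : LinearMap.trace k H T = Module.finrank k H * m := by
    rw [map_smul, trace_hit_mul hΛ h4, hΛ.regularCharacter_eq_one hS, one_mul, smul_eq_mul] at hm
    rw [← hm, mul_inv_cancel_left₀ hn]
  have hm0 : m ≠ 0 := by
    rintro rfl
    exact htr (by rw [htrT]; simp)
  have hT1 : T 1 = 1 := by simp [T]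
  exact congr($(eq_one_of_mul_self_eq_one hT hm0 htrT hT1 h1) h)

/-- Evaluating the twisted trace at `Λ` gives `Tr(S²) l(Λ) = 1`. The two nonzero factors supply `S⁴
= id` and the hypothesis on the trace. -/
lemma IsFactorizable.antipode_antipode [CharZero k] [IsSemisimpleRing H]
    (hR : IsFactorizable k R) (h : H) : antipode k (antipode k h) = h := by
  have := hR.moduleFinite
  obtain ⟨Λ, hΛ⟩ := exists_isNormalizedIntegral k H
  obtain ⟨l, hl⟩ := hR.bijective_drinfeldMap.2 Λ
  have hl := hR.isTwistedHaar hΛ hl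
  have h1 : twistedTrace k H 1 * l Λ = 1 := by
    rw [← smul_eq_mul, ← LinearMap.smul_apply, ← hl.twistedTrace_eq,
      hΛ.twistedTrace_eq_one hR.surjective_antipode]
  refine antipode_antipode_of_integrals hΛ hR.surjective_antipode
    (hl.antipode_pow_four hΛ (right_ne_zero_of_mul_eq_one h1) hR.bijective_antipode.1) ?_ h
  have h2 := left_ne_zero_of_mul_eq_one h1
  rwa [twistedTrace_apply, LinearMap.mulLeft_one, LinearMap.id_comp] at h2

end AntipodeSquared

/-! ### Characters and the integrality of their eigenvalues -/

section Characters

open Coalgebra WithConv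

universe u v

variable {k : Type u} {H : Type v} [Field k] [Ring H] [HopfAlgebra k H] {R : H ⊗[k] H}

/-- A linear form is a character if it is the trace of a finite-dimensional representation. -/
def IsCharacter (f : Module.Dual k H) : Prop :=
  ∃ (V : Type u) (_ : AddCommGroup V) (_ : Module k V) (_ : Module.Finite k V)
    (ρ : H →ₐ[k] Module.End k V), ∀ h, f h = LinearMap.trace k V (ρ h)

lemma isCharacter_counit : IsCharacter (counit (R := k) (A := H)) :=
  ⟨k, inferInstance, inferInstance, inferInstance,
    (Algebra.lmul k k).comp (Bialgebra.counitAlgHom k H), fun h ↦ by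
      have : Algebra.lmul k k (counit (R := k) h) = counit (R := k) h • LinearMap.id := by
        ext; simp
      rw [AlgHom.comp_apply, Bialgebra.counitAlgHom_apply, this, map_smul, LinearMap.trace_id]
      simp⟩

lemma IsCharacter.dualMul {f g : Module.Dual k H} (hf : IsCharacter f) (hg : IsCharacter g) :
    IsCharacter (dualMul f g) := by
  obtain ⟨V, _, _, _, ρ, hρ⟩ := hf
  obtain ⟨W, _, _, _, σ, hσ⟩ := hg
  refine ⟨V ⊗[k] W, inferInstance, inferInstance, inferInstance,
    (Module.endTensorEndAlgHom (R := k) (S := k) (A := k)).comp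
      ((Algebra.TensorProduct.map ρ σ).comp (Bialgebra.comulAlgHom k H)), fun h ↦ ?_⟩
  rw [dualMul_apply (ℛ k h), AlgHom.comp_apply, AlgHom.comp_apply, Bialgebra.comulAlgHom_apply,
    ← (ℛ k h).eq]
  simp only [map_sum, Algebra.TensorProduct.map_tmul, Module.endTensorEndAlgHom_apply, hρ, hσ]
  exact Finset.sum_congr rfl fun i _ ↦ (LinearMap.trace_tensorProduct' _ _).symm

lemma IsCharacter.comp_antipode {f : Module.Dual k H} (hf : IsCharacter f) :
    IsCharacter (f ∘ₗ antipode k) := by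
  obtain ⟨V, _, _, _, ρ, hρ⟩ := hf
  refine ⟨Module.Dual k V, inferInstance, inferInstance, inferInstance,
    .ofLinearMap (Module.Dual.transpose ∘ₗ ρ.toLinearMap ∘ₗ antipode k) ?_ ?_, fun h ↦ ?_⟩
  · ext; simp; rfl
  · intro x y
    ext
    simp [antipode_mul_antidistrib]
    rfl
  · rw [LinearMap.comp_apply, hρ]
    exact (LinearMap.trace_transpose' _).symm

lemma IsCharacter.mul_comm {f : Module.Dual k H} (hf : IsCharacter f) (x y : H) :
    f (x * y) = f (y * x) := by
  obtain ⟨V, _, _, _, ρ, hρ⟩ := hf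
  rw [hρ, hρ, map_mul ρ, map_mul ρ, LinearMap.trace_mul_comm]

/-- `Λ` acts as an idempotent, so its trace is a rank. -/
lemma IsCharacter.exists_natCast_eq {f : Module.Dual k H} (hf : IsCharacter f) {Λ : H}
    (hΛ : IsNormalizedIntegral k Λ) : ∃ m : ℕ, f Λ = m := by
  obtain ⟨V, _, _, _, ρ, hρ⟩ := hf
  have h1 : IsIdempotentElem (ρ Λ) := by
    rw [IsIdempotentElem, ← map_mul, hΛ.mul_eq, hΛ.counit_eq_one, one_smul]
  obtain ⟨m, hm⟩ := exists_natCast_eq_trace h1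
  exact ⟨m, by rw [hρ, hm]⟩

/-- The eigenvalues of multiplication by a character are algebraic integers. -/
lemma IsCharacter.isIntegral_eigenvalue {f E : Module.Dual k H} (hf : IsCharacter f) {Λ : H}
    (hΛ : IsNormalizedIntegral k Λ) {ι : Type*} [Fintype ι] {χ : ι → Module.Dual k H}
    (hχ : ∀ i, IsCharacter (χ i)) {c : ι → k} (hE : E = ∑ i, c i • χ i) (hE0 : E Λ ≠ 0)
    {a : k} (ha : HopfAlgebra.dualMul E f = a • E) : IsIntegral ℤ a := by
  -- All powers of `a` lie in this finitely generated group: evaluating `E fᵐ = aᵐ E` at `Λ` gives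
  -- `aᵐ E(Λ) = ∑ c_i (χ_i fᵐ)(Λ)`, where the values `(χ_i fᵐ)(Λ)` are natural numbers.
  let N : Submodule ℤ k := Submodule.span ℤ (Set.range fun i ↦ c i * (E Λ)⁻¹)
  have hN : N.FG := Submodule.fg_span (Set.finite_range _)
  have h1 : ∀ m : ℕ, ∃ g, IsCharacter g ∧ HopfAlgebra.dualMul E g = a ^ m • E := by
    intro m
    induction m with
    | zero => exact ⟨_, isCharacter_counit, by rw [dualMul_counit, pow_zero, one_smul]⟩
    | succ m ih =>
      obtain ⟨g, hg, hgE⟩ := ih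
      refine ⟨_, hg.dualMul hf, ?_⟩
      rw [← dualMul_assoc, hgE, smul_dualMul, ha, smul_smul, pow_succ]
  have h2 : ∀ m : ℕ, a ^ m ∈ N := by
    intro m
    obtain ⟨g, hg, hgE⟩ := h1 m
    have h3 : a ^ m = ∑ i, HopfAlgebra.dualMul (χ i) g Λ * (c i * (E Λ)⁻¹) := by
      have h4 : HopfAlgebra.dualMul E g Λ = ∑ i, c i * HopfAlgebra.dualMul (χ i) g Λ := by
        rw [hE, sum_dualMul]
        simp only [smul_dualMul, LinearMap.sum_apply, LinearMap.smul_apply, smul_eq_mul]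
      have h5 : a ^ m * E Λ = HopfAlgebra.dualMul E g Λ := congr($hgE Λ).symm
      rw [(eq_mul_inv_iff_mul_eq₀ hE0).mpr h5, h4, Finset.sum_mul]
      exact Finset.sum_congr rfl fun i _ ↦ by ring
    rw [h3]
    refine Submodule.sum_mem _ fun i _ ↦ ?_
    obtain ⟨n, hn⟩ := ((hχ i).dualMul hg).exists_natCast_eq hΛ
    rw [hn, ← nsmul_eq_mul]
    exact Submodule.smul_of_tower_mem _ _ (Submodule.subset_span ⟨i, rfl⟩)
  refine IsIntegral.of_mem_of_fg (Algebra.adjoin ℤ {a}) ?_ a (Algebra.self_mem_adjoin_singleton ℤ a)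
  have h3 : Subalgebra.toSubmodule (Algebra.adjoin ℤ {a}) ≤ N := by
    rw [Algebra.adjoin_eq_span, Submodule.span_le]
    intro x hx
    obtain ⟨m, rfl⟩ := Submonoid.mem_closure_singleton.mp hx
    exact h2 m
  have := isNoetherian_of_fg_of_noetherian N hN
  exact Submodule.FG.of_le hN h3

end Characters

/-! ### Duality of the integrals and the separability element -/

section TraceForms

open Coalgebra WithConv

variable {k H : Type*} [Field k] [Ring H] [HopfAlgebra k H] {R : H ⊗[k] H}

lemma contractLeft_eq_contractRight_switch (f : Module.Dual k H) (b : H ⊗[k] H) :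
    contractLeft k f b = contractRight k (switch k b) f := by
  induction b with
  | zero => simp
  | add s t hs ht => simp only [map_add, contractRight_add, hs, ht]
  | tmul x y => simp

lemma contractRight_antipodeTensor (f : Module.Dual k H) (b : H ⊗[k] H) :
    contractRight k (antipodeTensor k H b) f =
      antipode k (contractRight k b (f ∘ₗ antipode k)) := by
  induction b with
  | zero => simp
  | add s t hs ht => simp only [map_add, contractRight_add, hs, ht]
  | tmul x y => simp

lemma apply_contractRight (f g : Module.Dual k H) (b : H ⊗[k] H) :
    g (contractRight k b f) = f (contractLeft k g b) := by
  induction b with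
  | zero => simp
  | add s t hs ht => simp only [map_add, contractRight_add, hs, ht]
  | tmul x y => simp [mul_comm]

/-- The Drinfeld map exchanges the integrals. -/
lemma IsFactorizable.apply_drinfeldMap (hR : IsFactorizable k R) {Λ : H}
    (hΛ : IsNormalizedIntegral k Λ) {l : Module.Dual k H} (hl : drinfeldMap k R l = Λ)
    (f : Module.Dual k H) : l (drinfeldMap k R f) = f Λ := by
  -- Contracting the left leg of `τ(R) R` amounts to contracting the right leg of its switch, which
  -- is its image under `S ⊗ S`. Since `l ∘ S = l`, this gives `S(Φ l) = S(Λ) = Λ`.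
  rw [drinfeldMap, apply_contractRight, contractLeft_eq_contractRight_switch,
    ← hR.antipodeTensor_switch_mul, contractRight_antipodeTensor,
    (hR.isTwistedHaar hΛ hl).comp_antipode]
  change f (antipode k (drinfeldMap k R l)) = _
  rw [hl, hΛ.antipode_eq hR.surjective_antipode]

/-- The integral in the dual is the normalized regular character. -/
lemma IsTwistedHaar.regularCharacter_eq [Module.Finite k H] {l : Module.Dual k H}
    (hl : IsTwistedHaar l) (hS : ∀ h : H, antipode k (antipode k h) = h) :
    regularCharacter k H = (Module.finrank k H : k) • l := by
  have h1 : antipode k ∘ₗ antipode k = (LinearMap.id : H →ₗ[k] H) := LinearMap.ext hS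
  have h2 : twistedTrace k H = regularCharacter k H := by
    ext h
    rw [twistedTrace_apply, regularCharacter_apply, h1, LinearMap.comp_id]
  have h3 := hl.twistedTrace_eq
  rw [h2] at h3
  rw [h3, regularCharacter_apply, LinearMap.mulLeft_one, LinearMap.trace_id]

variable (k) in
/-- The separability element `Λ₁ ⊗ S(Λ₂)`. -/
noncomputable def casimir (Λ : H) : H ⊗[k] H := (antipode k).lTensor H (comul Λ)

lemma lTensor_antipode_mul (h : H) (t : H ⊗[k] H) :
    (antipode k (A := H)).lTensor H ((1 ⊗ₜ h) * t) =
      (antipode k).lTensor H t * (1 ⊗ₜ antipode k h) := by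
  induction t with
  | zero => simp
  | add s t hs ht => simp only [mul_add, map_add, add_mul, hs, ht]
  | tmul x y => simp [antipode_mul_antidistrib]

lemma lTensor_antipode_mul_left (h : H) (t : H ⊗[k] H) :
    (antipode k (A := H)).lTensor H ((h ⊗ₜ 1) * t) = (h ⊗ₜ 1) * (antipode k).lTensor H t := by
  induction t with
  | zero => simp
  | add s t hs ht => simp only [mul_add, map_add, hs, ht]
  | tmul x y => simp

lemma IsNormalizedIntegral.tmul_one_mul_casimir {Λ : H} (hΛ : IsNormalizedIntegral k Λ)
    (hS : Function.Surjective (antipode k (A := H))) (h : H) :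
    (h ⊗ₜ 1) * casimir k Λ = casimir k Λ * (1 ⊗ₜ h) := by
  obtain ⟨h, rfl⟩ := hS h
  rw [casimir, ← lTensor_antipode_mul, one_tmul_mul_comul_integral hΛ, lTensor_antipode_mul_left]

lemma IsNormalizedIntegral.mul'_casimir {Λ : H} (hΛ : IsNormalizedIntegral k Λ) :
    LinearMap.mul' k H (casimir k Λ) = 1 := by
  rw [casimir, mul_antipode_lTensor_comul_apply, hΛ.counit_eq_one, map_one]

lemma dualMul_comp_antipode_apply (f g : Module.Dual k H) (Λ : H) :
    dualMul f (g ∘ₗ antipode k) Λ = LinearMap.mul' k k (TensorProduct.map f g (casimir k Λ)) := by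
  rw [dualMul_apply_map, casimir]
  induction comul (R := k) Λ with
  | zero => simp
  | add s t hs ht => simp only [map_add, hs, ht]
  | tmul x y => simp

end TraceForms

/-! ### Matrix blocks, simple modules and orthogonality -/

section Blocks

open Coalgebra WithConv

universe u v

variable {k : Type u} {H : Type v} [Field k] [Ring H] [Algebra k H] {ι : Type*} {d : ι → ℕ}

/-- The projection to a matrix block. -/
def blockProj (e : H ≃ₐ[k] Π i, Matrix (Fin (d i)) (Fin (d i)) k) (i : ι) :
    H →ₐ[k] Matrix (Fin (d i)) (Fin (d i)) k :=
  (Pi.evalAlgHom k _ i).comp e.toAlgHom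

/-- The inclusion of a matrix block. -/
def blockIncl [DecidableEq ι] (e : H ≃ₐ[k] Π i, Matrix (Fin (d i)) (Fin (d i)) k) (i : ι) :
    Matrix (Fin (d i)) (Fin (d i)) k →ₗ[k] H :=
  e.symm.toLinearMap ∘ₗ LinearMap.single k (fun i ↦ Matrix (Fin (d i)) (Fin (d i)) k) i

/-- The trace of a matrix block. -/
def blockTrace (e : H ≃ₐ[k] Π i, Matrix (Fin (d i)) (Fin (d i)) k) (i : ι) : Module.Dual k H :=
  Matrix.traceLinearMap _ k k ∘ₗ (blockProj e i).toLinearMap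

variable (e : H ≃ₐ[k] Π i, Matrix (Fin (d i)) (Fin (d i)) k)

lemma blockProj_apply (i : ι) (h : H) : blockProj e i h = e h i := rfl

lemma blockTrace_apply (i : ι) (h : H) : blockTrace e i h = (blockProj e i h).trace := rfl

lemma isCharacter_blockTrace {k : Type u} {H : Type v} [Field k] [Ring H] [HopfAlgebra k H]
    (e : H ≃ₐ[k] Π i, Matrix (Fin (d i)) (Fin (d i)) k) (i : ι) :
    IsCharacter (blockTrace e i) :=
  ⟨Fin (d i) → k, inferInstance, inferInstance, inferInstance,
    (Matrix.toLinAlgEquiv' (R := k)).toAlgHom.comp (blockProj e i),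
    fun h ↦ (Matrix.trace_toLin'_eq (blockProj e i h)).symm⟩

variable [DecidableEq ι]

lemma apply_blockIncl (i : ι) (A : Matrix (Fin (d i)) (Fin (d i)) k) :
    e (blockIncl e i A) = Pi.single i A :=
  e.apply_symm_apply _

lemma blockProj_blockIncl (i : ι) (A : Matrix (Fin (d i)) (Fin (d i)) k) :
    blockProj e i (blockIncl e i A) = A := by
  rw [blockProj_apply, apply_blockIncl, Pi.single_eq_same]

lemma blockProj_blockIncl_of_ne {i j : ι} (h : j ≠ i) (A : Matrix (Fin (d i)) (Fin (d i)) k) :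
    blockProj e j (blockIncl e i A) = 0 := by
  rw [blockProj_apply, apply_blockIncl, Pi.single_eq_of_ne h]

lemma mul_blockIncl (i : ι) (h : H) (A : Matrix (Fin (d i)) (Fin (d i)) k) :
    h * blockIncl e i A = blockIncl e i (blockProj e i h * A) := by
  apply e.injective
  rw [map_mul, apply_blockIncl, apply_blockIncl]
  funext j
  by_cases hj : j = i
  · subst hj
    simp [blockProj_apply]
  · simp [Pi.single_eq_of_ne hj]

lemma blockIncl_mul (i : ι) (h : H) (A : Matrix (Fin (d i)) (Fin (d i)) k) :
    blockIncl e i A * h = blockIncl e i (A * blockProj e i h) := by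
  apply e.injective
  rw [map_mul, apply_blockIncl, apply_blockIncl]
  funext j
  by_cases hj : j = i
  · subst hj
    simp [blockProj_apply]
  · simp [Pi.single_eq_of_ne hj]

lemma sum_blockIncl_blockProj [Fintype ι] (h : H) : ∑ i, blockIncl e i (blockProj e i h) = h := by
  apply e.injective
  simp only [map_sum, apply_blockIncl, blockProj_apply]
  exact Finset.univ_sum_single _

lemma commute_blockIncl_one (i : ι) (h : H) : Commute (blockIncl e i 1) h := by
  rw [Commute, SemiconjBy, mul_blockIncl, blockIncl_mul, mul_one, one_mul]

lemma exists_eq_smul_trace {n : ℕ} [NeZero n] (g : Matrix (Fin n) (Fin n) k →ₗ[k] k)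
    (hg : ∀ A B, g (A * B) = g (B * A)) : ∃ c : k, ∀ A, g A = c * A.trace := by
  refine ⟨g (Matrix.single 0 0 1), fun A ↦ ?_⟩
  have h1 : ∀ i j, g (Matrix.single i j 1) = if i = j then g (Matrix.single 0 0 1) else 0 := by
    intro i j
    have h0 : Matrix.single i j (1 : k) = Matrix.single i 0 1 * Matrix.single 0 j 1 := by simp
    rw [h0, hg]
    split_ifs with h
    · rw [h, Matrix.single_mul_single_same, mul_one]
    · rw [Matrix.single_mul_single_of_ne (h := Ne.symm h), map_zero]
  have h2 : ∀ i j c, g (Matrix.single i j c) = c * g (Matrix.single i j 1) := by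
    intro i j c
    rw [← smul_eq_mul, ← map_smul, Matrix.smul_single, smul_eq_mul, mul_one]
  conv_lhs => rw [Matrix.matrix_eq_sum_single A]
  have h3 : ∀ i j, g (Matrix.single i j (A i j)) =
      A i j * if i = j then g (Matrix.single 0 0 1) else 0 :=
    fun i j ↦ by rw [h2, h1]
  simp only [map_sum, h3, mul_ite, mul_zero, Finset.sum_ite_eq, Finset.mem_univ, if_true]
  rw [← Finset.sum_mul, mul_comm]
  rfl

/-- Trace forms are combinations of the traces of the blocks. -/
lemma exists_eq_sum_blockTrace [Fintype ι] [∀ i, NeZero (d i)] (f : Module.Dual k H)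
    (hf : ∀ x y, f (x * y) = f (y * x)) : ∃ c : ι → k, f = ∑ i, c i • blockTrace e i := by
  have h1 : ∀ i, ∃ c : k, ∀ A, f (blockIncl e i A) = c * A.trace := by
    intro i
    refine exists_eq_smul_trace (f ∘ₗ blockIncl e i) fun A B ↦ ?_
    simp only [LinearMap.comp_apply]
    conv_lhs => rw [← blockProj_blockIncl e i A, ← mul_blockIncl, hf, mul_blockIncl,
      blockProj_blockIncl]
  choose c hc using h1
  refine ⟨c, ?_⟩
  ext h
  conv_lhs => rw [← sum_blockIncl_blockProj e h]
  simp [hc, blockTrace_apply]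

/-- The scalar by which a central element acts on a block. -/
def blockScalar [∀ i, NeZero (d i)] (i : ι) : Module.Dual k H :=
  Matrix.entryLinearMap k k 0 0 ∘ₗ (blockProj e i).toLinearMap

lemma mul_blockIncl_one_of_central [∀ i, NeZero (d i)] (i : ι) {z : H} (hz : ∀ h, Commute z h) :
    z * blockIncl e i 1 = blockScalar e i z • blockIncl e i 1 := by
  have h1 : blockProj e i z ∈ Set.range (Matrix.scalar (Fin (d i))) := by
    rw [Matrix.mem_range_scalar_iff_commute_single']
    intro p q
    have := congrArg (blockProj e i) (hz (blockIncl e i (Matrix.single p q 1))).eq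
    rw [map_mul, map_mul, blockProj_blockIncl] at this
    exact this.symm
  obtain ⟨a, ha⟩ := h1
  have h2 : blockScalar e i z = a := by
    simp [blockScalar, ← ha]
  rw [mul_blockIncl, mul_one, h2, ← map_smul, ← ha]
  congr 1
  ext p q
  simp [Matrix.one_apply, Matrix.diagonal_apply]

lemma blockScalar_blockIncl_one [∀ i, NeZero (d i)] (i : ι) :
    blockScalar e i (blockIncl e i 1) = 1 := by
  simp [blockScalar, blockProj_blockIncl]

lemma trace_mulLeft_blockIncl_one [Fintype ι] (i : ι) :
    LinearMap.trace k H (LinearMap.mulLeft k (blockIncl e i 1)) = (d i : k) ^ 2 := by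
  have : Module.Finite k H := Module.Finite.equiv e.toLinearEquiv.symm
  have h1 : LinearMap.mulLeft k (blockIncl e i 1) =
      blockIncl e i ∘ₗ (blockProj e i).toLinearMap := by
    ext h
    rw [LinearMap.mulLeft_apply, blockIncl_mul, one_mul]
    rfl
  have h2 : (blockProj e i).toLinearMap ∘ₗ blockIncl e i = LinearMap.id := by
    ext1 A
    exact blockProj_blockIncl e i A
  rw [h1, LinearMap.trace_comp_comm', h2, LinearMap.trace_id, Module.finrank_matrix]
  simp [sq]

/-- The dimension of a simple module is the size of one of the blocks. -/
lemma exists_finrank_eq [Fintype ι] [IsAlgClosed k]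
    (e : H ≃ₐ[k] Π i, Matrix (Fin (d i)) (Fin (d i)) k) (S : Type*) [AddCommGroup S] [Module k S] [Module H S]
    [IsScalarTower k H S] [IsSimpleModule H S] :
    ∃ i, Module.finrank k S = d i := by
  have : Module.Finite k H := Module.Finite.equiv e.toLinearEquiv.symm
  have : Module.Finite k S := Module.Finite.trans H S
  have : Nontrivial S := IsSimpleModule.nontrivial H S
  let ρ : H →ₐ[k] Module.End k S := Algebra.lsmul k k S
  have hscalar : ∀ g : Module.End H S, ∃ c : k, ∀ x, g x = c • x := by
    intro g
    obtain ⟨c, hc⟩ := (IsSimpleModule.algebraMap_end_bijective_of_isAlgClosed (A := H) k).2 g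
    exact ⟨c, fun x ↦ by rw [← hc]; rfl⟩
  have hsurj : Function.Surjective ρ := by
    intro g
    -- By Schur the commutant consists of scalars, so each `k`-linear map commutes with it and the
    -- density theorem applies.
    let g' : Module.End (Module.End H S) S :=
      { toFun := g
        map_add' := map_add g
        map_smul' := fun φ x ↦ by
          obtain ⟨c, hc⟩ := hscalar φ
          simp [hc] }
    obtain ⟨s, hs⟩ := Module.Finite.fg_top (R := k) (M := S)
    obtain ⟨r, hr⟩ := jacobson_density g' s
    refine ⟨r, LinearMap.ext_on hs fun x hx ↦ ?_⟩
    exact (hr x hx).symm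
  obtain ⟨i, hi⟩ : ∃ i, ρ (blockIncl e i 1) ≠ 0 := by
    by_contra! h
    have h1 := congrArg ρ (sum_blockIncl_blockProj e 1)
    simp only [map_one, map_sum, h, Finset.sum_const_zero] at h1
    exact zero_ne_one h1
  have hone : ρ (blockIncl e i 1) = 1 := by
    obtain ⟨c, hc⟩ := hscalar
      { toFun := ρ (blockIncl e i 1)
        map_add' := map_add _
        map_smul' := fun h x ↦ by
          change blockIncl e i 1 • h • x = h • blockIncl e i 1 • x
          rw [smul_smul, smul_smul, (commute_blockIncl_one e i h).eq] }
    have hc' : ρ (blockIncl e i 1) = c • 1 := LinearMap.ext hc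
    have h2 : ρ (blockIncl e i 1) * ρ (blockIncl e i 1) = ρ (blockIncl e i 1) := by
      rw [← map_mul, mul_blockIncl, blockProj_blockIncl, one_mul]
    have hc0 : c ≠ 0 := by
      rintro rfl
      exact hi (by rw [hc', zero_smul])
    rw [hc', smul_mul_smul_comm, one_mul, mul_smul, smul_right_injective _ hc0 |>.eq_iff] at h2
    rw [hc', h2]
  let F : Matrix (Fin (d i)) (Fin (d i)) k →ₐ[k] Module.End k S :=
    .ofLinearMap (ρ.toLinearMap ∘ₗ blockIncl e i) hone fun A B ↦ by
      simp only [LinearMap.comp_apply, AlgHom.toLinearMap_apply]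
      rw [← map_mul, mul_blockIncl, blockProj_blockIncl]
  have hFsurj : Function.Surjective F := by
    intro g
    obtain ⟨h, rfl⟩ := hsurj g
    refine ⟨blockProj e i h, ?_⟩
    change ρ (blockIncl e i (blockProj e i h)) = _
    rw [← mul_one (blockProj e i h), ← mul_blockIncl, map_mul, hone, mul_one]
  have hd : d i ≠ 0 := by
    intro h0
    have : IsEmpty (Fin (d i)) := by rw [h0]; infer_instance
    exact hi (by rw [Subsingleton.elim (1 : Matrix (Fin (d i)) (Fin (d i)) k) 0, map_zero,
      map_zero])
  have : Nonempty (Fin (d i)) := ⟨⟨0, Nat.pos_of_ne_zero hd⟩⟩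
  have hF : Function.Bijective F := ⟨F.toRingHom.injective, hFsurj⟩
  have h3 := (LinearEquiv.ofBijective F.toLinearMap hF).finrank_eq
  rw [Module.finrank_matrix, Module.finrank_linearMap] at h3
  simp only [Fintype.card_fin, Module.finrank_self, mul_one] at h3
  exact ⟨i, (Nat.mul_self_inj.mp h3).symm⟩

/-- The orthogonality relations for the characters of the blocks. -/
lemma dualMul_blockTrace {k : Type u} {H : Type v} [Field k] [Ring H] [HopfAlgebra k H]
    (e : H ≃ₐ[k] Π i, Matrix (Fin (d i)) (Fin (d i)) k) [∀ i, NeZero (d i)] {Λ : H}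
    (hΛ : IsNormalizedIntegral k Λ) (hS : Function.Surjective (antipode k (A := H))) (i j : ι) :
    dualMul (blockTrace e i) (blockTrace e j ∘ₗ antipode k) Λ = if i = j then 1 else 0 := by
  have hC := hΛ.tmul_one_mul_casimir hS
  have hC1 := hΛ.mul'_casimir
  rw [dualMul_comp_antipode_apply]
  set C := casimir k Λ
  split_ifs with hij
  · subst hij
    let t : Fin (d i) → Fin (d i) → Fin (d i) → Fin (d i) → H ⊗[k] H →ₗ[k] k := fun p q r s ↦
      LinearMap.mul' k k ∘ₗ TensorProduct.map
        (Matrix.entryLinearMap k k p q ∘ₗ (blockProj e i).toLinearMap)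
        (Matrix.entryLinearMap k k r s ∘ₗ (blockProj e i).toLinearMap)
    have ht : ∀ p q r s x y,
        t p q r s (x ⊗ₜ y) = blockProj e i x p q * blockProj e i y r s := fun _ _ _ _ _ _ ↦ rfl
    -- Carrying the matrix unit at `(0, v)` through `C` from the left leg to the right leg gives
    -- this relation. It reduces the double sum of traces to the `(0, 0)` entry of the product of
    -- the legs of `C`, which is `1`.
    have h1 : ∀ v q r s, t v q r s C = if v = s then t 0 q r 0 C else 0 := by
      intro v q r s
      have hl : ∀ T : H ⊗[k] H,
          t 0 q r s ((blockIncl e i (Matrix.single 0 v 1) ⊗ₜ 1) * T) = t v q r s T := by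
        intro T
        induction T with
        | zero => simp
        | add T T' h h' => simp only [mul_add, map_add, h, h']
        | tmul x y =>
          rw [Algebra.TensorProduct.tmul_mul_tmul, ht, ht, map_mul, blockProj_blockIncl,
            Matrix.single_mul_apply_same]
          simp
      have hr : ∀ T : H ⊗[k] H,
          t 0 q r s (T * (1 ⊗ₜ blockIncl e i (Matrix.single 0 v 1))) =
            if v = s then t 0 q r 0 T else 0 := by
        intro T
        induction T with
        | zero => simp
        | add T T' h h' =>
          simp only [add_mul, map_add, h, h']
          split_ifs <;> simp
        | tmul x y =>
          rw [Algebra.TensorProduct.tmul_mul_tmul, ht, ht, mul_one, map_mul, blockProj_blockIncl]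
          split_ifs with hvs
          · subst hvs
            rw [Matrix.mul_single_apply_same]
            simp
          · rw [Matrix.mul_single_apply_of_ne _ _ _ _ _ (Ne.symm hvs), mul_zero]
      rw [← hl, hC, hr]
    have h2 : ∀ T : H ⊗[k] H,
        LinearMap.mul' k k (TensorProduct.map (blockTrace e i) (blockTrace e i) T) =
          ∑ a, ∑ b, t a a b b T := by
      intro T
      induction T with
      | zero => simp
      | add T T' h h' => simp only [map_add, h, h', Finset.sum_add_distrib]
      | tmul x y =>
        simp [ht, blockTrace_apply, Matrix.trace, Finset.sum_mul_sum]
    have h3 : ∀ T : H ⊗[k] H,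
        blockProj e i (LinearMap.mul' k H T) 0 0 = ∑ a, t 0 a a 0 T := by
      intro T
      induction T with
      | zero => simp
      | add T T' h h' =>
        simp only [map_add, Matrix.add_apply, h, h', Finset.sum_add_distrib]
      | tmul x y => simp [ht, Matrix.mul_apply]
    rw [h2]
    simp only [fun a b ↦ h1 a a b b]
    have h4 := h3 C
    rw [hC1, map_one, Matrix.one_apply_eq] at h4
    rw [h4]
    refine Finset.sum_congr rfl fun a _ ↦ ?_
    rw [Finset.sum_ite_eq, if_pos (Finset.mem_univ _)]
  -- For distinct blocks, the central idempotent of block `i` acts as the identity under the first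
  -- trace and is killed by the second after passing through `C`.
  · have hl : ∀ T : H ⊗[k] H,
        LinearMap.mul' k k (TensorProduct.map (blockTrace e i) (blockTrace e j)
          ((blockIncl e i 1 ⊗ₜ 1) * T)) =
        LinearMap.mul' k k (TensorProduct.map (blockTrace e i) (blockTrace e j) T) := by
      intro T
      induction T with
      | zero => simp
      | add T T' h h' => simp only [mul_add, map_add, h, h']
      | tmul x y => simp [blockTrace_apply, blockProj_blockIncl]
    have hr : ∀ T : H ⊗[k] H,
        LinearMap.mul' k k (TensorProduct.map (blockTrace e i) (blockTrace e j)
          (T * (1 ⊗ₜ blockIncl e i 1))) = 0 := by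
      intro T
      induction T with
      | zero => simp
      | add T T' h h' => simp only [add_mul, map_add, h, h', add_zero]
      | tmul x y => simp [blockTrace_apply, blockProj_blockIncl_of_ne e (Ne.symm hij)]
    rw [← hl, hC, hr]

end Blocks

/-! ### Algebraic integrality of the quotient and divisibility -/

section Divisibility

open Coalgebra WithConv

universe u v

variable {k : Type u} {H : Type v} [Field k] [Ring H] [HopfAlgebra k H] {R : H ⊗[k] H}
  {ι : Type*} [Fintype ι] [DecidableEq ι] {d : ι → ℕ} [∀ i, NeZero (d i)]

lemma dvd_of_isIntegral_div [CharZero k] {m n : ℕ} (hm : m ≠ 0)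
    (h : IsIntegral ℤ ((n : k) / m)) : m ∣ n := by
  have h1 : IsIntegral ℤ ((n : ℚ) / m) := by
    rw [← isIntegral_algebraMap_iff (algebraMap ℚ k).injective]
    simpa using h
  obtain ⟨a, ha⟩ := IsIntegrallyClosed.isIntegral_iff.mp h1
  have hm' : (m : ℚ) ≠ 0 := Nat.cast_ne_zero.mpr hm
  rw [eq_div_iff hm', algebraMap_int_eq, eq_intCast] at ha
  have h2 : a * m = (n : ℤ) := by exact_mod_cast ha
  exact Int.natCast_dvd_natCast.mp ⟨a, by rw [← h2, mul_comm]⟩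

/-- The quotient of the dimension of a semisimple factorizable Hopf algebra by the square of the
dimension of a simple module is an algebraic integer. -/
lemma IsFactorizable.isIntegral_div [CharZero k] [IsSemisimpleRing H] (hR : IsFactorizable k R)
    (e : H ≃ₐ[k] Π i, Matrix (Fin (d i)) (Fin (d i)) k) (i : ι) :
    IsIntegral ℤ ((Module.finrank k H : k) / (d i ^ 2 : ℕ)) := by
  have := hR.moduleFinite
  have hS := hR.surjective_antipode
  have hSS := hR.antipode_antipode
  obtain ⟨Λ, hΛ⟩ := exists_isNormalizedIntegral k H
  obtain ⟨l, hl⟩ := hR.bijective_drinfeldMap.2 Λ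
  have hlH := hR.isTwistedHaar hΛ hl
  obtain ⟨E, hE⟩ := hR.bijective_drinfeldMap.2 (blockIncl e i 1)
  have hcentral : ∀ f : Module.Dual k H, (∀ h, Commute (drinfeldMap k R f) h) ↔
      ∀ x y, f (x * y) = f (y * x) := by
    intro f
    rw [hR.forall_commute_iff]
    simp only [hSS]
  have hEc : ∀ h, Commute (drinfeldMap k R E) h := by
    rw [hE]
    exact commute_blockIncl_one e i
  obtain ⟨c, hc⟩ := exists_eq_sum_blockTrace e E ((hcentral E).mp hEc)
  -- Reading the scalar off as a matrix entry makes `a` linear in all forms, so it can be applied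
  -- termwise to the expansion of `E`.
  let a : Module.Dual k H → k := fun f ↦ blockScalar e i (drinfeldMap k R f)
  have ha : ∀ f, IsCharacter f → dualMul E f = a f • E := by
    intro f hf
    have hfc := (hcentral f).mpr hf.mul_comm
    apply hR.bijective_drinfeldMap.1
    rw [hR.drinfeldMap_dualMul E f hfc, map_smul, hE, ← (hfc _).eq,
      mul_blockIncl_one_of_central e i hfc]
  -- The regular character, equal to `n l`, takes the value `d²` at the block idempotent `Φ E`,
  -- while `l(Φ E) = E(Λ)`.
  have hn0 : (Module.finrank k H : k) * E Λ = (d i : k) ^ 2 := by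
    have h1 := congr($(hlH.regularCharacter_eq hSS) (blockIncl e i 1))
    rw [regularCharacter_apply, trace_mulLeft_blockIncl_one, LinearMap.smul_apply, smul_eq_mul,
      ← hE, hR.apply_drinfeldMap hΛ hl] at h1
    exact h1.symm
  have hd0 : (d i : k) ^ 2 ≠ 0 := pow_ne_zero _ (Nat.cast_ne_zero.mpr (NeZero.ne _))
  have hE0 : E Λ ≠ 0 := right_ne_zero_of_mul (hn0 ▸ hd0)
  let χ := fun j ↦ blockTrace e j
  have hχ : ∀ j, IsCharacter (χ j) := isCharacter_blockTrace e
  have hint : ∀ f, IsCharacter f → IsIntegral ℤ (a f) :=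
    fun f hf ↦ hf.isIntegral_eigenvalue hΛ hχ hc hE0 (ha f hf)
  have hcj : ∀ j, a (χ j ∘ₗ antipode k) * E Λ = c j := by
    intro j
    rw [← smul_eq_mul, ← LinearMap.smul_apply, ← ha _ (hχ j).comp_antipode]
    conv_lhs => rw [hc, sum_dualMul]
    simp only [smul_dualMul, LinearMap.sum_apply, LinearMap.smul_apply, χ,
      dualMul_blockTrace e hΛ hS, smul_eq_mul, mul_ite, mul_one, mul_zero]
    simp
  have haE : ∑ j, a (χ j) * c j = 1 := by
    have h1 : a E = 1 := by
      simp only [a, hE, blockScalar_blockIncl_one]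
    rw [← h1]
    simp only [a]
    conv_rhs => rw [hc]
    simp [χ, mul_comm]
  have hsum : (Module.finrank k H : k) / (d i ^ 2 : ℕ) =
      ∑ j, a (χ j) * a (χ j ∘ₗ antipode k) := by
    have h1 : (∑ j, a (χ j) * a (χ j ∘ₗ antipode k)) * E Λ = 1 := by
      rw [← haE, Finset.sum_mul]
      exact Finset.sum_congr rfl fun j _ ↦ by rw [← hcj, mul_assoc]
    rw [Nat.cast_pow, div_eq_iff hd0, ← hn0, mul_left_comm, h1, mul_one]
  rw [hsum]
  exact IsIntegral.sum _ fun j _ ↦ (hint _ (hχ j)).mul (hint _ (hχ j).comp_antipode)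

end Divisibility

end HopfAlgebra

theorem theoremT {k H S : Type*} [Field k] [IsAlgClosed k] [CharZero k]
    [Ring H] [HopfAlgebra k H] [IsSemisimpleRing H]
    (R : H ⊗[k] H) (hR : HopfAlgebra.IsFactorizable k R)
    [AddCommGroup S] [Module k S] [Module H S] [IsScalarTower k H S] [IsSimpleModule H S] :
    Module.finrank k S ^ 2 ∣ Module.finrank k H := by
  have := hR.moduleFinite
  obtain ⟨n, d, hd, ⟨e⟩⟩ := IsSemisimpleRing.exists_algEquiv_pi_matrix_of_isAlgClosed k H
  obtain ⟨i, hi⟩ := HopfAlgebra.exists_finrank_eq e S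
  rw [hi]
  exact HopfAlgebra.dvd_of_isIntegral_div (pow_ne_zero _ (NeZero.ne _)) (hR.isIntegral_div e i)
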